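/- Consider the fading coherent channel $y=\sqrt{snr}\,h\,x+n$ with independent complex random variables $x,h,n$, where $n\sim\mathcal{CN}(0,1)$ and $h\sim\mathcal{CN}(\mu,2\sigma^2)$ with $\mu\in\mathbb{C}$ and $\sigma>0$ ($\mu=0$: Rayleigh fading; $\mu\neq0$: Ricean fading); here $\mathcal{CN}(\mu,2\sigma^2)$ is the law of a complex variable whose real and imaginary parts are independent real Gaussians with means $\mathrm{Re}\,\mu$, $\mathrm{Im}\,\mu$ and variance $\sigma^2$ each. The input $x$ has either an arbitrary discrete distribution with finite support in $\mathbb{C}$, or one of the following distributions: uniform on the unit circle ($\infty$-PSK), uniform on the segment $[-\sqrt3,\sqrt3]\subset\mathbb{R}\subset\mathbb{C}$ ($\infty$-PAM), uniform on the square $[-\sqrt{3/2},\sqrt{3/2}]\times[-\sqrt{3/2},\sqrt{3/2}]$ ($\infty$-QAM), or $\mathcal{CN}(0,1)$. For $h_0\in\mathbb{C}$ and $snr\ge 0$ put $y_{h_0}=\sqrt{snr}\,h_0x+n$, let $mmse_{h_0}(snr)=E\{|h_0x-E\{h_0x\mid y_{h_0}\}|^2\}$, and let $I_{h_0}(snr)$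 be the mutual information (in nats) between $x$ and $y_{h_0}$, that is, the expected logarithm of the density of the law of $(x,y_{h_0})$ with respect to the product of its marginals. Let $\overline{mmse}(snr)=E_h\{mmse_h(snr)\}$, $\overline{I}(snr)=E_h\{I_h(snr)\}$, and let $mmse=mmse_1$ be the canonical MMSE. Let ${}_1F_1(a;b;z)=\sum_{k\ge0}\frac{(a)_k}{(b)_k}\frac{z^k}{k!}$. Then $mmse$ has one-sided derivatives $mmse^{(m)}(0^+)$ of all orders at $0$ (precisely: for every $k$ it is $C^k$, up to the boundary, on a one-sided neighbourhood $[0,\varepsilon_k)$ of $0$); for every $snr\ge0$ the random variable $mmse_h(snr)$ is integrable and $\overline{I}(snr)<\infty$; and, as $snr\to0^+$, $$\overline{mmse}(snr)\sim e^{-\frac{|\mu|^2}{2\sigma^2}}\sum_{m=0}^{\infty}(m+1)(2\sigma^2)^{m+1}\,{}_1F_1\!\left(2+m;1;\tfrac{|\mu|^2}{2\sigma^2}\right)mmse^{(m)}(0^+)\,snr^m,$$ $$\overline{I}(snr)\sim e^{-\frac{|\mu|^2}{2\sigma^2}}\sum_{m=0}^{\infty}(2\sigma^2)^{m+1}\,{}_1F_1\!\left(2+m;1;\tfrac{|\mu|^2}{2\sigma^2}\right)mmse^{(m)}(0^+)\,snr^{m+1}.$$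 Here $f(t)\sim\sum_{k\ge0}a_k\varphi_k(t)$ as $t\to0^+$, for continuous functions $\varphi_k$ with $\varphi_{k+1}=o(\varphi_k)$, means that $f(t)=\sum_{k=0}^{m}a_k\varphi_k(t)+O(\varphi_{m+1}(t))$ as $t\to0^+$ for every $m\ge0$; the formal series need not converge. -/

import Mathlib

open MeasureTheory ProbabilityTheory Filter Topology Asymptotics
open scoped ENNReal

namespace FadingChannel

noncomputable section

/-- The complex Gaussian law `CN(μ, v)`: real and imaginary parts are independent real Gaussians
with means `Re μ`, `Im μ` and variance `v / 2` each (so `CN(μ, 2σ²)` has variance `σ²` in each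
real coordinate, and `CN(0, 1)` is the circularly symmetric law with zero mean, unit variance). -/
def complexGaussian (μ : ℂ) (v : ℝ) : Measure ℂ :=
  ((gaussianReal μ.re (Real.toNNReal (v / 2))).prod
    (gaussianReal μ.im (Real.toNNReal (v / 2)))).map Complex.measurableEquivRealProd.symm

/-- Unit-power `∞`-PSK: the uniform law on the unit circle, as the law of `exp(iθ)` with `θ`
uniform on `[0, 2π]`. -/
def pskLaw : Measure ℂ :=
  (ProbabilityTheory.cond (volume : Measure ℝ) (Set.Icc 0 (2 * Real.pi))).map
    (fun θ : ℝ => Complex.exp (θ * Complex.I))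

/-- Unit-power `∞`-PAM: the uniform law on the segment `[-√3, √3]` of the real axis of `ℂ`. -/
def pamLaw : Measure ℂ :=
  (ProbabilityTheory.cond (volume : Measure ℝ) (Set.Icc (-√3) (√3))).map
    (fun t : ℝ => (t : ℂ))

/-- Unit-power `∞`-QAM: the uniform law on the square `[-√(3/2), √(3/2)] × [-√(3/2), √(3/2)]`. -/
def qamLaw : Measure ℂ :=
  ProbabilityTheory.cond (volume : Measure ℂ)
    (Set.Icc (-√(3 / 2)) (√(3 / 2)) ×ℂ Set.Icc (-√(3 / 2)) (√(3 / 2)))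

/-- The input laws: an arbitrary discrete law with finite support, or one of the
continuous laws `∞`-PSK, `∞`-PAM, `∞`-QAM, standard complex Gaussian. -/
def IsInputLaw (ν : Measure ℂ) : Prop :=
  (∃ S : Finset ℂ, ∀ᵐ z ∂ν, z ∈ S) ∨
    ν = pskLaw ∨ ν = pamLaw ∨ ν = qamLaw ∨ ν = complexGaussian 0 1

section Channel

variable {Ω : Type*} [MeasurableSpace Ω]

/-- The channel output `y = √snr · h₀ · x + n` for the channel gain `h₀`. -/
def output (x n : Ω → ℂ) (h₀ : ℂ) (snr : ℝ) (ω : Ω) : ℂ :=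
  ((√snr : ℝ) : ℂ) * h₀ * x ω + n ω

/-- The conditional MMSE `mmse_{h₀}(snr) = E |h₀ x - E[h₀ x | y]|²` given that the channel gain
equals `h₀`. Since the gain is independent of `(x, n)`, the conditional law of `(x, y)` given
`h = h₀` is the law of `(x, √snr h₀ x + n)`. -/
def condMmse (P : Measure Ω) (x n : Ω → ℂ) (h₀ : ℂ) (snr : ℝ) : ℝ :=
  ∫ ω, ‖h₀ * x ω -
    (P[fun ω' => h₀ * x ω' | MeasurableSpace.comap (output x n h₀ snr) inferInstance]) ω‖ ^ 2 ∂P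

/-- The conditional mutual information `I_{h₀}(snr)` (in nats) between the input and the output
given that the channel gain equals `h₀`: the expected logarithm of the density of the joint law of
`(x, y)` with respect to the product of the marginal laws. -/
def condMutualInfo (P : Measure Ω) (x n : Ω → ℂ) (h₀ : ℂ) (snr : ℝ) : ℝ≥0∞ :=
  InformationTheory.klDiv (P.map (fun ω => (x ω, output x n h₀ snr ω)))
    ((P.map x).prod (P.map (output x n h₀ snr)))

/-- The canonical MMSE, `mmse(snr) = mmse_1(snr)`, of the channel `y = √snr x + n`. -/
def canonicalMmse (P : Measure Ω) (x n : Ω → ℂ) (snr : ℝ) : ℝ :=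
  condMmse P x n 1 snr

/-- The average MMSE `E_h {mmse_h(snr)}`. -/
def avgMmse (P : Measure Ω) (x h n : Ω → ℂ) (snr : ℝ) : ℝ :=
  ∫ ω, condMmse P x n (h ω) snr ∂P

/-- The average mutual information `E_h {I_h(snr)}`. -/
def avgMutualInfo (P : Measure Ω) (x h n : Ω → ℂ) (snr : ℝ) : ℝ≥0∞ :=
  ∫⁻ ω, condMutualInfo P x n (h ω) snr ∂P

end Channel

/-- The confluent hypergeometric series `₁F₁(a; b; z) = ∑ (a)ₙ / (b)ₙ · zⁿ / n!`. -/
def confluentHypergeometric (a b z : ℝ) : ℝ :=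
  ∑' n : ℕ, (ascPochhammer ℝ n).eval a / (ascPochhammer ℝ n).eval b * (z ^ n / (n.factorial : ℝ))

/-- The asymptotic expansion `f ∼ ∑ₙ aₙ φₙ` along the filter `l`, with respect to an asymptotic
sequence of continuous functions: `f = ∑_{n ≤ m} aₙ φₙ + O(φ_{m+1})` for every `m`. The formal
series need not converge. -/
def HasAsymptoticExpansion (f : ℝ → ℝ) (a : ℕ → ℝ) (φ : ℕ → ℝ → ℝ) (l : Filter ℝ) : Prop :=
  (∀ n, Continuous (φ n)) ∧ (∀ n, φ (n + 1) =o[l] φ n) ∧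
    ∀ m : ℕ, (fun t => f t - ∑ n ∈ Finset.range (m + 1), a n * φ n t) =O[l] φ (m + 1)

end

end FadingChannel

/-! Fix a gain `h₀`. The noise is invariant under rotations, so only the modulus of `√snr h₀`
matters: the conditional MMSE is `|h₀|² m(|h₀|² snr)` and the conditional information is `J(|h₀|²
snr)`, where `m` is the canonical MMSE and `J` the canonical mutual information (`condMmse_eq`,
`condMutualInfo_eq`). Everything then rests on four facts.

(a) `m` is smooth on `[0, ∞)` up to the boundary, and `0 ≤ m ≤ E|x|²`. For bounded inputs, Bayes'
formula gives `m` as a Gaussian integral of `|N|²/q`, with `q` the output density relative to the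
noise and `N` the unnormalised posterior mean. In the variable `s = √snr` these are integrals of
exponentials of quadratics in `s`; all their derivatives, and `1/q`, grow at most exponentially in
the output, so differentiation under the Gaussian integral is always allowed. The result is smooth
and even in `s`, hence smooth in `s² = snr` by Whitney's theorem (`contDiffOn_comp_sqrt_of_even`).
The Gaussian input is unbounded but explicit: `m(t) = 1/(1+t)`, `J(t) = log(1+t)`.

(b) The I-MMSE relation: `J' = m` and `J(0) = 0`. For bounded inputs one differentiates `E log q_s(s
x + n)` in `s`. The explicit `s`-dependence of `q_s` contributes nothing, because `q_s` has integral
one for all `s`; the motion of the argument contributes `2s E|x̂|²`, with `x̂` the posterior mean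
(`integral_shiftedDensityDeriv_div`).

(c) Taylor's formula for `m` at `0` has a remainder `C t^(k+1)` on the whole half-line, not only
near `0`, since `m` is bounded (`exists_taylor_bound_Ici`). This global form is what allows the
substitution `t = |h|² snr` with `h` unbounded, followed by averaging, as `|h|` has all moments.

(d) `E|h|^(2k+2) = (k+1)! (2σ²)^(k+1) e^(-z) ₁F₁(k+2; 1; z)` with `z = |μ|²/(2σ²)`
(`integral_norm_pow_complexGaussian`). Against the Taylor coefficient `m^(k)(0)/k!` the factorials
leave `k+1`; the integration from `m` to `J` divides this factor out. -/

namespace FadingChannel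

open ComplexConjugate

/-! ### The standard complex Gaussian law -/

/-- The circularly symmetric complex Gaussian law with unit variance. -/
noncomputable abbrev stdGaussian : Measure ℂ := complexGaussian 0 1

instance isProbabilityMeasure_complexGaussian (μ : ℂ) (v : ℝ) :
    IsProbabilityMeasure (complexGaussian μ v) := by
  unfold complexGaussian
  exact Measure.isProbabilityMeasure_map (by fun_prop)

/-- The density of the standard complex Gaussian law. -/
noncomputable def stdGaussianDensity (z : ℂ) : ℝ := Real.exp (-‖z‖ ^ 2) / Real.pi

lemma stdGaussianDensity_nonneg (z : ℂ) : 0 ≤ stdGaussianDensity z := by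
  unfold stdGaussianDensity; positivity

@[fun_prop]
lemma measurable_stdGaussianDensity : Measurable stdGaussianDensity := by
  unfold stdGaussianDensity; fun_prop

lemma stdGaussian_eq_withDensity :
    stdGaussian = volume.withDensity (fun z => ENNReal.ofReal (stdGaussianDensity z)) := by
  have hv : Real.toNNReal ((1 : ℝ) / 2) ≠ 0 := by simp
  unfold stdGaussian complexGaussian
  simp only [Complex.zero_re, Complex.zero_im]
  rw [gaussianReal_of_var_ne_zero _ hv,
    prod_withDensity (measurable_gaussianPDF _ _) (measurable_gaussianPDF _ _)]
  have hmp := Complex.volume_preserving_equiv_real_prod.symm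
  ext s hs
  rw [Measure.map_apply (by fun_prop) hs, withDensity_apply _ hs,
    withDensity_apply _ (Complex.measurableEquivRealProd.symm.measurable hs),
    ← hmp.setLIntegral_comp_preimage hs (by fun_prop)]
  refine setLIntegral_congr_fun (Complex.measurableEquivRealProd.symm.measurable hs) ?_
  rintro ⟨a, b⟩ -
  simp only [gaussianPDF, gaussianPDFReal]
  rw [← ENNReal.ofReal_mul (by positivity)]
  congr 1
  have : ((Real.toNNReal ((1 : ℝ) / 2) : NNReal) : ℝ) = 1 / 2 := Real.coe_toNNReal _ (by norm_num)
  rw [this, stdGaussianDensity, ← Complex.normSq_eq_norm_sq]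
  have h2 : Complex.normSq (Complex.measurableEquivRealProd.symm (a, b)) = a ^ 2 + b ^ 2 := by
    simp [Complex.normSq_apply, Complex.measurableEquivRealProd_symm_apply]; ring
  rw [h2, show 2 * Real.pi * (1 / 2) = Real.pi by ring]
  have h3 : (√Real.pi)⁻¹ * (√Real.pi)⁻¹ = Real.pi⁻¹ := by
    rw [← mul_inv, Real.mul_self_sqrt Real.pi_pos.le]
  calc _ = ((√Real.pi)⁻¹ * (√Real.pi)⁻¹) *
      (Real.exp (-(a - 0) ^ 2 / (2 * (1 / 2))) * Real.exp (-(b - 0) ^ 2 / (2 * (1 / 2)))) := by ring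
    _ = _ := by rw [h3, ← Real.exp_add, div_eq_mul_inv _ Real.pi, mul_comm]; congr 2; ring

/-- The logarithm of the density of `w + z` with respect to the law of `z`, for `z` standard
Gaussian. -/
noncomputable def tilt (y w : ℂ) : ℝ := 2 * (y * conj w).re - ‖w‖ ^ 2

@[fun_prop]
lemma measurable_tilt {α : Type*} [MeasurableSpace α] {f g : α → ℂ} (hf : Measurable f)
    (hg : Measurable g) : Measurable (fun a => tilt (f a) (g a)) := by
  unfold tilt
  have : Measurable fun a => conj (g a) := Complex.continuous_conj.measurable.comp hg
  have h2 : Measurable fun a => (f a * conj (g a)).re :=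
    Complex.continuous_re.measurable.comp (hf.mul this)
  fun_prop

lemma tilt_eq (y w : ℂ) : tilt y w = ‖y‖ ^ 2 - ‖y - w‖ ^ 2 := by
  rw [tilt, ← Complex.normSq_eq_norm_sq, ← Complex.normSq_eq_norm_sq, ← Complex.normSq_eq_norm_sq,
    Complex.normSq_sub]
  ring

lemma tilt_le (y w : ℂ) : tilt y w ≤ ‖y‖ ^ 2 := by
  rw [tilt_eq]; nlinarith [sq_nonneg ‖y - w‖]

lemma stdGaussianDensity_mul_exp_tilt (y w : ℂ) :
    stdGaussianDensity y * Real.exp (tilt y w) = stdGaussianDensity (y - w) := by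
  rw [stdGaussianDensity, stdGaussianDensity, div_mul_eq_mul_div, ← Real.exp_add, tilt_eq]
  congr 2; ring

lemma lintegral_stdGaussian {f : ℂ → ℝ≥0∞} (hf : Measurable f) :
    ∫⁻ z, f z ∂stdGaussian = ∫⁻ z, ENNReal.ofReal (stdGaussianDensity z) * f z := by
  rw [stdGaussian_eq_withDensity, lintegral_withDensity_eq_lintegral_mul _ (by fun_prop) hf]
  rfl

/-- Cameron–Martin formula for the standard complex Gaussian law. -/
lemma lintegral_stdGaussian_add (w : ℂ) {f : ℂ → ℝ≥0∞} (hf : Measurable f) :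
    ∫⁻ z, f (w + z) ∂stdGaussian = ∫⁻ z, ENNReal.ofReal (Real.exp (tilt z w)) * f z ∂stdGaussian := by
  rw [lintegral_stdGaussian (by fun_prop), lintegral_stdGaussian (by fun_prop),
    ← lintegral_add_left_eq_self (μ := (volume : Measure ℂ))
      (fun z => ENNReal.ofReal (stdGaussianDensity z) *
        (ENNReal.ofReal (Real.exp (tilt z w)) * f z)) w]
  refine lintegral_congr fun z => ?_
  rw [← mul_assoc, ← ENNReal.ofReal_mul (stdGaussianDensity_nonneg _),
    stdGaussianDensity_mul_exp_tilt, add_sub_cancel_left]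

/-- Rotations preserve both the area and the radial density. This symmetry kills the off-diagonal
moments and reduces complex gains to real ones. -/
lemma map_const_mul_stdGaussian {u : ℂ} (hu : ‖u‖ = 1) :
    stdGaussian.map (fun z => u * z) = stdGaussian := by
  have hmp : MeasurePreserving (fun z : ℂ => u * z) volume volume := by
    have := (rotation ⟨u, by simpa [Submonoid.unitSphere] using hu⟩).measurePreserving
    exact this
  refine Measure.ext_of_lintegral _ fun f hf => ?_
  rw [lintegral_map hf (by fun_prop), lintegral_stdGaussian (by fun_prop), lintegral_stdGaussian hf,
    ← hmp.lintegral_comp (f := fun z => ENNReal.ofReal (stdGaussianDensity z) * f z)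
      (by fun_prop)]
  refine lintegral_congr fun z => ?_
  simp [stdGaussianDensity, hu]

lemma complexGaussian_eq_map (μ : ℂ) {σ : ℝ} (hσ : 0 < σ) :
    complexGaussian μ (2 * σ ^ 2) =
      stdGaussian.map (fun z => μ + ((√2 * σ : ℝ) : ℂ) * z) := by
  have h1 : ∀ m : ℝ, gaussianReal m (Real.toNNReal (2 * σ ^ 2 / 2)) =
      (gaussianReal 0 (Real.toNNReal (1 / 2))).map (fun t => m + (√2 * σ) * t) := by
    intro m
    have : (fun t : ℝ => m + (√2 * σ) * t) = (fun t => m + t) ∘ (fun t => (√2 * σ) * t) := rfl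
    rw [this, ← Measure.map_map (by fun_prop) (by fun_prop), gaussianReal_map_const_mul,
      gaussianReal_map_const_add]
    congr 1
    · simp
    · ext
      simp [mul_pow]
      rw [max_eq_left (by positivity)]; ring
  unfold stdGaussian complexGaussian
  rw [h1, h1, Measure.map_prod_map _ _ (by fun_prop) (by fun_prop),
    Measure.map_map (by fun_prop) (by fun_prop), Measure.map_map (by fun_prop) (by fun_prop)]
  congr 1
  ext p
  apply Complex.ext <;> simp [Complex.measurableEquivRealProd_symm_apply]

lemma integral_stdGaussian {E : Type*} [NormedAddCommGroup E] [NormedSpace ℝ E] (f : ℂ → E) :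
    ∫ z, f z ∂stdGaussian = ∫ z, stdGaussianDensity z • f z := by
  rw [stdGaussian_eq_withDensity, integral_withDensity_eq_integral_toReal_smul (by fun_prop)
    (by simp)]
  simp [ENNReal.toReal_ofReal, stdGaussianDensity_nonneg]

lemma integrable_exp_mul_norm_stdGaussian (c : ℝ) :
    Integrable (fun z : ℂ => Real.exp (c * ‖z‖)) stdGaussian := by
  rw [stdGaussian_eq_withDensity, integrable_withDensity_iff_integrable_smul' (by fun_prop)
    (by simp)]
  have h1 : Integrable (fun v : ℂ => Complex.exp (-(1 / 2 : ℂ) * (‖v‖ : ℂ) ^ 2)) := by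
    simpa using GaussianFourier.integrable_cexp_neg_mul_sq_norm_add (V := ℂ) (b := 1 / 2)
      (by norm_num) 0 0
  have h2 := h1.norm.const_mul (Real.exp (c ^ 2 / 2) / Real.pi)
  refine h2.mono' (by fun_prop) (ae_of_all _ fun z => ?_)
  have h3 : ‖Complex.exp (-(1 / 2 : ℂ) * (‖z‖ : ℂ) ^ 2)‖ = Real.exp (-(1 / 2) * ‖z‖ ^ 2) := by
    rw [Complex.norm_exp]; congr 1; simp [← Complex.ofReal_pow]
  rw [h3, ENNReal.toReal_ofReal (stdGaussianDensity_nonneg _), stdGaussianDensity, smul_eq_mul,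
    Real.norm_of_nonneg (by positivity), div_mul_eq_mul_div, div_mul_eq_mul_div, ← Real.exp_add,
    ← Real.exp_add]
  refine div_le_div_of_nonneg_right (Real.exp_le_exp.mpr ?_) Real.pi_pos.le
  -- Half of the Gaussian exponent absorbs the linear term: `c r - r² ≤ c²/2 - r²/2`.
  nlinarith [sq_nonneg (c - ‖z‖)]

lemma integrable_norm_pow_stdGaussian (k : ℕ) :
    Integrable (fun z : ℂ => ‖z‖ ^ k) stdGaussian := by
  refine ((integrable_exp_mul_norm_stdGaussian 1).const_mul (k.factorial : ℝ)).mono' (by fun_prop)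
    (ae_of_all _ fun z => ?_)
  have := Real.pow_div_factorial_le_exp ‖z‖ (norm_nonneg z) k
  rw [div_le_iff₀ (by positivity)] at this
  rw [Real.norm_of_nonneg (by positivity), one_mul]
  linarith

lemma integral_norm_pow_stdGaussian (j : ℕ) :
    ∫ z, ‖z‖ ^ (2 * j) ∂stdGaussian = j.factorial := by
  have h := Complex.integral_rpow_mul_exp_neg_rpow (p := 2) (q := ((2 * j : ℕ) : ℝ))
    (by norm_num) (by have : (0 : ℝ) ≤ ((2 * j : ℕ) : ℝ) := by positivity
                      linarith)
  rw [integral_stdGaussian]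
  have h2 : ∀ z : ℂ, stdGaussianDensity z • ‖z‖ ^ (2 * j) =
      Real.pi⁻¹ * (‖z‖ ^ (((2 * j : ℕ) : ℝ)) * Real.exp (-‖z‖ ^ (2 : ℝ))) := by
    intro z
    rw [stdGaussianDensity, Real.rpow_natCast, smul_eq_mul, Real.rpow_two]; ring
  simp_rw [h2]
  rw [integral_const_mul, h]
  have h3 : (((2 * j : ℕ) : ℝ) + 2) / 2 = j + 1 := by push_cast; ring
  rw [h3, Real.Gamma_nat_eq_factorial]
  field_simp

lemma integrable_pow_mul_conj_pow_stdGaussian (a b : ℕ) :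
    Integrable (fun z : ℂ => z ^ a * (conj z) ^ b) stdGaussian := by
  refine (integrable_norm_pow_stdGaussian (a + b)).mono' ?_ (ae_of_all _ fun z => ?_)
  · exact (by fun_prop : Continuous fun z : ℂ => z ^ a * (conj z) ^ b).aestronglyMeasurable
  · simp [pow_add]

lemma integral_pow_mul_conj_pow_stdGaussian (a b : ℕ) :
    ∫ z : ℂ, z ^ a * (conj z) ^ b ∂stdGaussian = if a = b then (a.factorial : ℂ) else 0 := by
  split_ifs with hab
  · subst hab
    have : ∀ z : ℂ, z ^ a * (conj z) ^ a = ((‖z‖ ^ (2 * a) : ℝ) : ℂ) := by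
      intro z
      rw [← mul_pow, Complex.mul_conj, Complex.normSq_eq_norm_sq, ← Complex.ofReal_pow, ← pow_mul]
    simp_rw [this]
    rw [integral_complex_ofReal, integral_norm_pow_stdGaussian]
    simp
  · set I := ∫ z : ℂ, z ^ a * (conj z) ^ b ∂stdGaussian with hI
    -- rotating by one radian multiplies the moment by `exp (i (a - b)) ≠ 1`
    set u : ℂ := Complex.exp (Complex.I) with hu
    have hun : ‖u‖ = 1 := by simpa using Complex.norm_exp_ofReal_mul_I 1
    have hinv : conj u = Complex.exp (-Complex.I) := by rw [hu, ← Complex.exp_conj]; simp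
    have hrot : I = (u ^ a * (conj u) ^ b) * I := by
      conv_lhs => rw [hI, ← map_const_mul_stdGaussian hun]
      rw [integral_map (by fun_prop)
        (by fun_prop : Continuous fun z : ℂ => z ^ a * (conj z) ^ b).aestronglyMeasurable, hI,
        ← integral_const_mul]
      congr 1 with z
      simp only [map_mul]; ring
    have hne : u ^ a * (conj u) ^ b ≠ 1 := by
      rw [hinv, hu, ← Complex.exp_nat_mul, ← Complex.exp_nat_mul, ← Complex.exp_add]
      intro h
      obtain ⟨n, hn⟩ := Complex.exp_eq_one_iff.mp h
      have h1 : ((a : ℂ) - b) * Complex.I = (n * (2 * Real.pi)) * Complex.I := by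
        linear_combination hn
      have h2 := mul_right_cancel₀ Complex.I_ne_zero h1
      have h3 : ((a : ℝ) - b) = n * (2 * Real.pi) := by exact_mod_cast h2
      rcases eq_or_ne n 0 with rfl | hn0
      · apply hab; simp at h3; exact_mod_cast (sub_eq_zero.mp h3)
      -- A nontrivial phase `a - b = 2πn` with integers `a ≠ b` would make `π` rational; this is why
      -- rotation by a single radian suffices for all moments.
      · apply irrational_pi
        refine ⟨((a : ℚ) - b) / (n * 2), ?_⟩
        have : (n : ℝ) ≠ 0 := by exact_mod_cast hn0
        push_cast
        rw [h3]; field_simp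
    have : (1 - u ^ a * (conj u) ^ b) * I = 0 := by linear_combination hrot
    rcases mul_eq_zero.mp this with h | h
    · exact absurd (sub_eq_zero.mp h).symm hne
    · exact h

/-! ### Moments of a noncentral complex Gaussian and `₁F₁` -/

lemma ascPochhammer_eval_succ_div (k n : ℕ) :
    (ascPochhammer ℝ n).eval (1 + (k : ℝ)) / (ascPochhammer ℝ n).eval 1 =
      ((n + k).choose n : ℝ) := by
  have h1 : (ascPochhammer ℝ n).eval (1 + (k : ℝ)) = ((k + 1).ascFactorial n : ℝ) := by
    rw [← ascPochhammer_nat_eq_ascFactorial, show (1 + (k : ℝ)) = ((k + 1 : ℕ) : ℝ) by push_cast; ring,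
      ascPochhammer_eval_cast]
  rw [h1, ascPochhammer_eval_one, Nat.ascFactorial_eq_factorial_mul_choose]
  rw [Nat.cast_mul, mul_div_cancel_left₀ _ (by positivity), add_comm k n]

/-- Kummer's transformation of `₁F₁(k + 1; 1; z)` into a polynomial. -/
lemma confluentHypergeometric_succ_one (k : ℕ) (z : ℝ) :
    confluentHypergeometric (1 + k) 1 z =
      Real.exp z * ∑ j ∈ Finset.range (k + 1), (k.choose j : ℝ) * (z ^ j / j.factorial) := by
  set f : ℕ → ℝ := fun j => (k.choose j : ℝ) * (z ^ j / j.factorial) with hf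
  set g : ℕ → ℝ := fun n => z ^ n / n.factorial with hg
  have hf0 : ∀ j ∉ Finset.range (k + 1), f j = 0 := by
    intro j hj
    simp only [Finset.mem_range, not_lt] at hj
    simp [hf, Nat.choose_eq_zero_of_lt (show k < j by omega)]
  have hfs : Summable fun j => ‖f j‖ :=
    summable_of_ne_finset_zero (s := Finset.range (k + 1)) fun j hj => by simp [hf0 j hj]
  have hgs : Summable fun n => ‖g n‖ := by
    simpa [hg, norm_div, norm_pow] using Real.summable_pow_div_factorial ‖z‖
  have he : Real.exp z = ∑' n, g n := by
    rw [Real.exp_eq_exp_ℝ, NormedSpace.exp_eq_tsum_div]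
  rw [he, ← tsum_eq_sum (L := SummationFilter.unconditional ℕ) hf0, mul_comm,
    tsum_mul_tsum_eq_tsum_sum_antidiagonal_of_summable_norm hfs hgs, confluentHypergeometric]
  refine tsum_congr fun n => ?_
  -- Vandermonde's identity matches the `n`-th coefficient of `₁F₁` with the Cauchy product of the
  -- polynomial and `exp z`.
  rw [ascPochhammer_eval_succ_div, add_comm n k, Nat.add_choose_eq]
  push_cast
  rw [Finset.sum_mul]
  refine Finset.sum_congr rfl fun p hp => ?_
  have hp' := Finset.HasAntidiagonal.mem_antidiagonal.mp hp
  have h1 : (n.choose p.2 : ℝ) = n.factorial / (p.2.factorial * p.1.factorial) := by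
    rw [eq_div_iff (by positivity), ← hp',
      ← Nat.add_choose_mul_factorial_mul_factorial p.1 p.2]
    push_cast; ring
  simp only [hf, hg]
  rw [h1, ← hp', pow_add]
  field_simp

/-- Expand `|μ + τz|^(2k)`, `τ = √2 σ`, in powers of `z` and `conj z`. Only the diagonal terms have
nonzero mean, and their sum is the Kummer polynomial of `confluentHypergeometric_succ_one`. -/
lemma integral_norm_pow_complexGaussian (μ : ℂ) {σ : ℝ} (hσ : 0 < σ) (k : ℕ) :
    Integrable (fun z : ℂ => ‖z‖ ^ (2 * k)) (complexGaussian μ (2 * σ ^ 2)) ∧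
    ∫ z, ‖z‖ ^ (2 * k) ∂(complexGaussian μ (2 * σ ^ 2)) =
      k.factorial * (2 * σ ^ 2) ^ k * (Real.exp (-(‖μ‖ ^ 2 / (2 * σ ^ 2))) *
        confluentHypergeometric (1 + k) 1 (‖μ‖ ^ 2 / (2 * σ ^ 2))) := by
  set τ : ℝ := √2 * σ with hτ
  have hτ2 : τ ^ 2 = 2 * σ ^ 2 := by rw [hτ, mul_pow, Real.sq_sqrt (by norm_num)]
  have hτ0 : 0 < τ := by positivity
  set c : ℕ → ℕ → ℂ := fun i j =>
    (τ : ℂ) ^ i * μ ^ (k - i) * k.choose i * ((τ : ℂ) ^ j * (conj μ) ^ (k - j) * k.choose j) with hc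
  have hexp : ∀ z : ℂ, ((‖μ + (τ : ℂ) * z‖ ^ (2 * k) : ℝ) : ℂ) =
      ∑ i ∈ Finset.range (k + 1), ∑ j ∈ Finset.range (k + 1), c i j * (z ^ i * (conj z) ^ j) := by
    intro z
    rw [pow_mul, ← Complex.normSq_eq_norm_sq, Complex.ofReal_pow, ← Complex.mul_conj, mul_pow,
      add_comm μ, add_pow, map_add, add_pow, Finset.sum_mul_sum]
    refine Finset.sum_congr rfl fun i _ => Finset.sum_congr rfl fun j _ => ?_
    simp only [map_mul, Complex.conj_ofReal, hc]; ring
  have hint : Integrable (fun z : ℂ => ((‖μ + (τ : ℂ) * z‖ ^ (2 * k) : ℝ) : ℂ)) stdGaussian := by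
    simp_rw [hexp]
    exact integrable_finsetSum _ fun i _ => integrable_finsetSum _ fun j _ =>
      (integrable_pow_mul_conj_pow_stdGaussian i j).const_mul _
  have hintR : Integrable (fun z : ℂ => ‖μ + (τ : ℂ) * z‖ ^ (2 * k)) stdGaussian := by
    exact hint.re.congr (ae_of_all _ fun z => Complex.ofReal_re _)
  rw [complexGaussian_eq_map μ hσ, ← hτ,
    integrable_map_measure (by fun_prop) (by fun_prop)]
  refine ⟨hintR, ?_⟩
  rw [integral_map (by fun_prop) (by fun_prop), confluentHypergeometric_succ_one, ← hτ2,
    ← mul_assoc (Real.exp _), ← Real.exp_add, neg_add_cancel, Real.exp_zero, one_mul]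
  have hval : ((∫ z : ℂ, ‖μ + (τ : ℂ) * z‖ ^ (2 * k) ∂stdGaussian : ℝ) : ℂ) =
      ((∑ i ∈ Finset.range (k + 1),
        (k.choose i : ℝ) ^ 2 * i.factorial * (τ ^ 2) ^ i * (‖μ‖ ^ 2) ^ (k - i) : ℝ) : ℂ) := by
    rw [← integral_complex_ofReal]
    simp_rw [hexp]
    rw [integral_finsetSum _ fun i _ => integrable_finsetSum _ fun j _ =>
      (integrable_pow_mul_conj_pow_stdGaussian i j).const_mul _]
    push_cast
    refine Finset.sum_congr rfl fun i hi => ?_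
    rw [integral_finsetSum _ fun j _ => (integrable_pow_mul_conj_pow_stdGaussian i j).const_mul _]
    simp_rw [integral_const_mul, integral_pow_mul_conj_pow_stdGaussian]
    simp only [mul_ite, mul_zero, Finset.sum_ite_eq, hi, if_true, hc]
    have : ((‖μ‖ : ℂ) ^ 2) = μ * conj μ := by
      rw [Complex.mul_conj, Complex.normSq_eq_norm_sq]; norm_cast
    rw [this, mul_pow]; ring
  -- The moment sum is indexed by the power of `τz`, the Kummer polynomial by the power of `|μ|²`;
  -- the reflection `i ↦ k - i` matches them.
  rw [Complex.ofReal_inj.mp hval, ← Finset.sum_range_reflect, Finset.mul_sum]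
  refine Finset.sum_congr rfl fun j hj => ?_
  have hj' : j ≤ k := Nat.lt_succ_iff.mp (Finset.mem_range.mp hj)
  have h1 : k + 1 - 1 - j = k - j := by omega
  have h2 : k - (k - j) = j := by omega
  rw [h1, h2, Nat.choose_symm hj']
  have h3 : (k.factorial : ℝ) = k.choose j * j.factorial * (k - j).factorial := by
    exact_mod_cast (Nat.choose_mul_factorial_mul_factorial hj').symm
  have h4 : (τ ^ 2) ^ k = (τ ^ 2) ^ (k - j) * (τ ^ 2) ^ j := by
    rw [← pow_add, Nat.sub_add_cancel hj']
  rw [h3, h4, div_pow]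
  field_simp

/-! ### Smooth families of functions of exponential growth -/

section SmoothFamily

set_option linter.unusedSectionVars false

variable {α β γ : Type*} [MeasurableSpace α] [MeasurableSpace β] [MeasurableSpace γ]

/-- `g s` grows on `A` at most exponentially with respect to the weight `w`, locally uniformly
in `s`. -/
def ExpGrowth (A : Set α) (w : α → ℝ) (g : ℝ → α → ℝ) : Prop :=
  ∀ R : ℝ, ∃ C : ℝ, 0 ≤ C ∧ ∀ s, |s| ≤ R → ∀ a ∈ A, |g s a| ≤ C * Real.exp (C * w a)

/-- `g` is `k` times differentiable in the parameter, and the derivatives up to order `k` are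
measurable and of exponential growth. -/
def SmoothFamily (A : Set α) (w : α → ℝ) : ℕ → (ℝ → α → ℝ) → Prop
  | 0, g => (∀ s, Measurable (g s)) ∧ ExpGrowth A w g
  | k + 1, g => ((∀ s, Measurable (g s)) ∧ ExpGrowth A w g) ∧
      ∃ g' : ℝ → α → ℝ, (∀ s, ∀ a ∈ A, HasDerivAt (fun s => g s a) (g' s a) s) ∧
        SmoothFamily A w k g'

variable {A : Set α} {w : α → ℝ} {f g : ℝ → α → ℝ} {k : ℕ}

lemma SmoothFamily.zero (h : SmoothFamily A w k g) : SmoothFamily A w 0 g := by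
  cases k with
  | zero => exact h
  | succ k => exact h.1

lemma SmoothFamily.measurable (h : SmoothFamily A w k g) (s : ℝ) : Measurable (g s) :=
  h.zero.1 s

lemma SmoothFamily.expGrowth (h : SmoothFamily A w k g) : ExpGrowth A w g := h.zero.2

lemma SmoothFamily.of_succ (h : SmoothFamily A w (k + 1) g) : SmoothFamily A w k g := by
  induction k generalizing g with
  | zero => exact h.1
  | succ k ih =>
    obtain ⟨h0, g', hd, hg'⟩ := h
    exact ⟨h0, g', hd, ih hg'⟩

lemma ExpGrowth.add (hw : ∀ a ∈ A, 0 ≤ w a) (hf : ExpGrowth A w f) (hg : ExpGrowth A w g) :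
    ExpGrowth A w (fun s a => f s a + g s a) := by
  intro R
  obtain ⟨C, hC, h1⟩ := hf R
  obtain ⟨D, hD, h2⟩ := hg R
  refine ⟨C + D, by positivity, fun s hs a ha => (abs_add_le _ _).trans ?_⟩
  have hwa := hw a ha
  calc _ ≤ C * Real.exp (C * w a) + D * Real.exp (D * w a) := add_le_add (h1 s hs a ha) (h2 s hs a ha)
    _ ≤ C * Real.exp ((C + D) * w a) + D * Real.exp ((C + D) * w a) := by
        gcongr <;> linarith
    _ = _ := by ring

lemma ExpGrowth.mul (hw : ∀ a ∈ A, 0 ≤ w a) (hf : ExpGrowth A w f) (hg : ExpGrowth A w g) :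
    ExpGrowth A w (fun s a => f s a * g s a) := by
  intro R
  obtain ⟨C, hC, h1⟩ := hf R
  obtain ⟨D, hD, h2⟩ := hg R
  -- One constant serves as prefactor and as rate, so it must dominate both `C * D` and `C + D`.
  refine ⟨C + D + C * D, by positivity, fun s hs a ha => ?_⟩
  have hwa := hw a ha
  rw [abs_mul]
  calc _ ≤ (C * Real.exp (C * w a)) * (D * Real.exp (D * w a)) :=
        mul_le_mul (h1 s hs a ha) (h2 s hs a ha) (abs_nonneg _) (by positivity)
    _ = (C * D) * Real.exp ((C + D) * w a) := by rw [add_mul, Real.exp_add]; ring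
    _ ≤ _ := by
        have hCD := mul_nonneg hC hD
        refine mul_le_mul (by linarith) (Real.exp_le_exp.mpr ?_) (Real.exp_pos _).le (by positivity)
        exact mul_le_mul_of_nonneg_right (by linarith) hwa

lemma ExpGrowth.mono (hf : ExpGrowth A w f) (h : ∀ s, ∀ a ∈ A, |g s a| ≤ |f s a|) :
    ExpGrowth A w g := by
  intro R
  obtain ⟨C, hC, h1⟩ := hf R
  exact ⟨C, hC, fun s hs a ha => (h s a ha).trans (h1 s hs a ha)⟩

lemma expGrowth_param (hw : ∀ a ∈ A, 0 ≤ w a) {c : ℝ → ℝ} (hc : Continuous c) :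
    ExpGrowth A w (fun s _ => c s) := by
  intro R
  obtain ⟨C, hC⟩ := (isCompact_Icc (a := -R) (b := R)).exists_bound_of_continuousOn hc.continuousOn
  refine ⟨|C|, abs_nonneg _, fun s hs a ha => ?_⟩
  have h1 : |c s| ≤ C := hC s (abs_le.mp hs)
  have h2 : 1 ≤ Real.exp (|C| * w a) := Real.one_le_exp (mul_nonneg (abs_nonneg _) (hw a ha))
  nlinarith [le_abs_self C, abs_nonneg C]

lemma expGrowth_of_le {u : α → ℝ} {C : ℝ} (hC : 0 ≤ C)
    (h : ∀ a ∈ A, |u a| ≤ C * Real.exp (C * w a)) : ExpGrowth A w (fun _ a => u a) :=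
  fun _ => ⟨C, hC, fun _ _ a ha => h a ha⟩

lemma smoothFamily_of_le {u : α → ℝ} (hu : Measurable u) {C : ℝ} (hC : 0 ≤ C)
    (h : ∀ a ∈ A, |u a| ≤ C * Real.exp (C * w a)) : SmoothFamily A w k (fun _ a => u a) := by
  have h0 : ∀ k, SmoothFamily A w k (fun _ _ => 0) := by
    intro k
    have hg : ExpGrowth A w (fun _ _ => 0) := expGrowth_of_le le_rfl (by simp)
    induction k with
    | zero => exact ⟨fun _ => measurable_const, hg⟩
    | succ k ih =>
      exact ⟨⟨fun _ => measurable_const, hg⟩, _, fun s a _ => hasDerivAt_const _ _, ih⟩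
  cases k with
  | zero => exact ⟨fun _ => hu, expGrowth_of_le hC h⟩
  | succ k =>
    exact ⟨⟨fun _ => hu, expGrowth_of_le hC h⟩, _, fun s a _ => hasDerivAt_const _ _, h0 k⟩

lemma smoothFamily_const (hw : ∀ a ∈ A, 0 ≤ w a) (c : ℝ) :
    SmoothFamily A w k (fun _ _ => c) :=
  smoothFamily_of_le measurable_const (abs_nonneg c) fun a ha => by
    have h2 : 1 ≤ Real.exp (|c| * w a) := Real.one_le_exp (mul_nonneg (abs_nonneg _) (hw a ha))
    nlinarith [abs_nonneg c]

lemma smoothFamily_id (hw : ∀ a ∈ A, 0 ≤ w a) : SmoothFamily A w k (fun s _ => s) := by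
  cases k with
  | zero => exact ⟨fun _ => measurable_const, expGrowth_param hw continuous_id⟩
  | succ k =>
    exact ⟨⟨fun _ => measurable_const, expGrowth_param hw continuous_id⟩, fun _ _ => 1,
      fun s a _ => hasDerivAt_id s, smoothFamily_const hw 1⟩

lemma SmoothFamily.add (hw : ∀ a ∈ A, 0 ≤ w a) (hf : SmoothFamily A w k f)
    (hg : SmoothFamily A w k g) : SmoothFamily A w k (fun s a => f s a + g s a) := by
  have h0 : (∀ s, Measurable fun a => f s a + g s a) ∧ ExpGrowth A w (fun s a => f s a + g s a) :=
    ⟨fun s => (hf.measurable s).add (hg.measurable s), hf.expGrowth.add hw hg.expGrowth⟩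
  induction k generalizing f g with
  | zero => exact h0
  | succ k ih =>
    obtain ⟨-, f', hdf, hf'⟩ := hf
    obtain ⟨-, g', hdg, hg'⟩ := hg
    exact ⟨h0, _, fun s a ha => (hdf s a ha).add (hdg s a ha), ih hf' hg'
      ⟨fun s => (hf'.measurable s).add (hg'.measurable s), hf'.expGrowth.add hw hg'.expGrowth⟩⟩

lemma SmoothFamily.mul (hw : ∀ a ∈ A, 0 ≤ w a) (hf : SmoothFamily A w k f)
    (hg : SmoothFamily A w k g) : SmoothFamily A w k (fun s a => f s a * g s a) := by
  induction k generalizing f g with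
  | zero => exact ⟨fun s => (hf.measurable s).mul (hg.measurable s), hf.expGrowth.mul hw hg.expGrowth⟩
  | succ k ih =>
    have hfk := hf.of_succ
    have hgk := hg.of_succ
    obtain ⟨hf0, f', hdf, hf'⟩ := hf
    obtain ⟨hg0, g', hdg, hg'⟩ := hg
    exact ⟨⟨fun s => (hf0.1 s).mul (hg0.1 s), hf0.2.mul hw hg0.2⟩, _,
      fun s a ha => (hdf s a ha).mul (hdg s a ha), (ih hf' hgk).add hw (ih hfk hg')⟩

lemma SmoothFamily.const_mul (hw : ∀ a ∈ A, 0 ≤ w a) (c : ℝ) (hg : SmoothFamily A w k g) :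
    SmoothFamily A w k (fun s a => c * g s a) :=
  (smoothFamily_const hw c).mul hw hg

/-- Growth of the exponential has to be assumed: exponential growth of `g` alone would give only a
doubly exponential bound. Derivatives then need no further assumption, being products with
derivatives of `g`. -/
lemma SmoothFamily.exp (hw : ∀ a ∈ A, 0 ≤ w a) (hg : SmoothFamily A w k g)
    (he : ExpGrowth A w (fun s a => Real.exp (g s a))) :
    SmoothFamily A w k (fun s a => Real.exp (g s a)) := by
  induction k generalizing g with
  | zero => exact ⟨fun s => (hg.measurable s).exp, he⟩
  | succ k ih =>
    have hgk := hg.of_succ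
    obtain ⟨hg0, g', hdg, hg'⟩ := hg
    exact ⟨⟨fun s => (hg0.1 s).exp, he⟩, _, fun s a ha => (hdg s a ha).exp, (ih hgk he).mul hw hg'⟩

lemma SmoothFamily.inv (hw : ∀ a ∈ A, 0 ≤ w a) (hg : SmoothFamily A w k g)
    (h0 : ∀ s, ∀ a ∈ A, g s a ≠ 0) (hi : ExpGrowth A w (fun s a => (g s a)⁻¹)) :
    SmoothFamily A w k (fun s a => (g s a)⁻¹) := by
  induction k generalizing g with
  | zero => exact ⟨fun s => (hg.measurable s).inv, hi⟩
  | succ k ih =>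
    have hgk := hg.of_succ
    obtain ⟨hg0, g', hdg, hg'⟩ := hg
    refine ⟨⟨fun s => (hg0.1 s).inv, hi⟩,
      fun s a => ((-1) * g' s a) * ((g s a)⁻¹ * (g s a)⁻¹), fun s a ha => ?_, ?_⟩
    · convert! (hdg s a ha).inv (h0 s a ha) using 1
      field_simp
    · exact (hg'.const_mul hw (-1)).mul hw ((ih hgk h0 hi).mul hw (ih hgk h0 hi))

/-- Applying `log t ≤ t - 1` to `t` and to `1/t` gives `|log t| ≤ t + 1/t`. -/
lemma ExpGrowth.log (hw : ∀ a ∈ A, 0 ≤ w a) (hg : ExpGrowth A w g)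
    (h0 : ∀ s, ∀ a ∈ A, 0 < g s a) (hi : ExpGrowth A w (fun s a => (g s a)⁻¹)) :
    ExpGrowth A w (fun s a => Real.log (g s a)) := by
  refine (hg.add hw hi).mono fun s a ha => ?_
  have hp := h0 s a ha
  have h1 := Real.log_le_sub_one_of_pos hp
  have h2 := Real.log_le_sub_one_of_pos (inv_pos.mpr hp)
  rw [Real.log_inv] at h2
  have h3 := inv_pos.mpr hp
  rw [abs_of_pos (add_pos hp h3), abs_le]
  constructor <;> linarith

lemma SmoothFamily.log (hw : ∀ a ∈ A, 0 ≤ w a) (hg : SmoothFamily A w k g)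
    (h0 : ∀ s, ∀ a ∈ A, 0 < g s a) (hi : ExpGrowth A w (fun s a => (g s a)⁻¹)) :
    SmoothFamily A w k (fun s a => Real.log (g s a)) := by
  have hlog := hg.expGrowth.log hw h0 hi
  cases k with
  | zero => exact ⟨fun s => (hg.measurable s).log, hlog⟩
  | succ k =>
    have hgk := hg.of_succ
    obtain ⟨hg0, g', hdg, hg'⟩ := hg
    refine ⟨⟨fun s => (hg0.1 s).log, hlog⟩, fun s a => g' s a * (g s a)⁻¹, fun s a ha => ?_,
      hg'.mul hw (hgk.inv hw (fun s a ha => (h0 s a ha).ne') hi)⟩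
    simpa [div_eq_mul_inv] using (hdg s a ha).log (h0 s a ha).ne'

lemma SmoothFamily.comp {A' : Set γ} {w' : γ → ℝ} (hg : SmoothFamily A w k g) {φ : γ → α}
    (hφ : Measurable φ) (hA : ∀ c ∈ A', φ c ∈ A) (hww : ∀ c ∈ A', w (φ c) ≤ w' c) :
    SmoothFamily A' w' k (fun s c => g s (φ c)) := by
  have hgr : ∀ {g : ℝ → α → ℝ}, ExpGrowth A w g → ExpGrowth A' w' (fun s c => g s (φ c)) := by
    intro g hg R
    obtain ⟨C, hC, h⟩ := hg R
    refine ⟨C, hC, fun s hs c hc => (h s hs _ (hA c hc)).trans ?_⟩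
    gcongr
    exact hww c hc
  induction k generalizing g with
  | zero => exact ⟨fun s => (hg.measurable s).comp hφ, hgr hg.expGrowth⟩
  | succ k ih =>
    obtain ⟨hg0, g', hdg, hg'⟩ := hg
    exact ⟨⟨fun s => (hg0.1 s).comp hφ, hgr hg0.2⟩, _, fun s c hc => hdg s _ (hA c hc), ih hg'⟩

variable {B : Set β} {w₂ : β → ℝ} {ρ : Measure β} [SFinite ρ] {G G' : ℝ → α × β → ℝ}

/-- The weight on a product. -/
def sumWeight (w : α → ℝ) (w₂ : β → ℝ) (p : α × β) : ℝ := w p.1 + w₂ p.2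

lemma SmoothFamily.integrable_right (hG : SmoothFamily (A ×ˢ B) (sumWeight w w₂) k G)
    (hB : ∀ᵐ b ∂ρ, b ∈ B) (hexp : ∀ C : ℝ, Integrable (fun b => Real.exp (C * w₂ b)) ρ)
    {a : α} (ha : a ∈ A) (s : ℝ) : Integrable (fun b => G s (a, b)) ρ := by
  obtain ⟨C, hC, h⟩ := hG.expGrowth |s|
  refine ((hexp C).const_mul (C * Real.exp (C * w a))).mono'
    ((hG.measurable s).comp (by fun_prop)).aestronglyMeasurable ?_
  filter_upwards [hB] with b hb
  have := h s le_rfl (a, b) ⟨ha, hb⟩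
  rwa [sumWeight, mul_add, Real.exp_add, ← mul_assoc] at this

lemma ExpGrowth.integral_right (hG : ExpGrowth (A ×ˢ B) (sumWeight w w₂) G)
    (hw : ∀ a ∈ A, 0 ≤ w a) (hB : ∀ᵐ b ∂ρ, b ∈ B)
    (hexp : ∀ C : ℝ, Integrable (fun b => Real.exp (C * w₂ b)) ρ) :
    ExpGrowth A w (fun s a => ∫ b, G s (a, b) ∂ρ) := by
  intro R
  obtain ⟨C, hC, h⟩ := hG R
  set I := ∫ b, Real.exp (C * w₂ b) ∂ρ with hI
  have hI0 : 0 ≤ I := integral_nonneg fun b => (Real.exp_pos _).le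
  refine ⟨C + C * I, by positivity, fun s hs a ha => ?_⟩
  have h1 : ‖∫ b, G s (a, b) ∂ρ‖ ≤ ∫ b, (C * Real.exp (C * w a)) * Real.exp (C * w₂ b) ∂ρ := by
    refine norm_integral_le_of_norm_le ((hexp C).const_mul _) ?_
    filter_upwards [hB] with b hb
    have := h s hs (a, b) ⟨ha, hb⟩
    rwa [sumWeight, mul_add, Real.exp_add, ← mul_assoc] at this
  rw [integral_const_mul, ← hI] at h1
  refine h1.trans ?_
  have hwa := hw a ha
  have hCI : 0 ≤ C * I := by positivity
  calc C * Real.exp (C * w a) * I = (C * I) * Real.exp (C * w a) := by ring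
    _ ≤ _ := by gcongr <;> linarith

lemma SmoothFamily.hasDerivAt_integral (hG : SmoothFamily (A ×ˢ B) (sumWeight w w₂) 0 G)
    (hG' : SmoothFamily (A ×ˢ B) (sumWeight w w₂) 0 G')
    (hd : ∀ s, ∀ p ∈ A ×ˢ B, HasDerivAt (fun s => G s p) (G' s p) s)
    (hB : ∀ᵐ b ∂ρ, b ∈ B) (hexp : ∀ C : ℝ, Integrable (fun b => Real.exp (C * w₂ b)) ρ)
    {a : α} (ha : a ∈ A) (s : ℝ) :
    HasDerivAt (fun s => ∫ b, G s (a, b) ∂ρ) (∫ b, G' s (a, b) ∂ρ) s := by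
  -- The radius `|s| + 1` covers the unit ball around `s`, on which one dominating function is
  -- needed.
  obtain ⟨C, hC, h⟩ := hG'.expGrowth (|s| + 1)
  refine (hasDerivAt_integral_of_dominated_loc_of_deriv_le (s := Metric.ball s 1)
    (bound := fun b => C * Real.exp (C * w a) * Real.exp (C * w₂ b))
    (F := fun s b => G s (a, b)) (F' := fun s b => G' s (a, b))
    (Metric.ball_mem_nhds s one_pos) (Eventually.of_forall fun t => ?_)
    (hG.integrable_right hB hexp ha s) ?_ ?_ ((hexp C).const_mul _) ?_).2
  · exact ((hG.measurable t).comp (by fun_prop)).aestronglyMeasurable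
  · exact ((hG'.measurable s).comp (by fun_prop)).aestronglyMeasurable
  · filter_upwards [hB] with b hb t ht
    have ht' : |t| ≤ |s| + 1 := by
      have h1 : |t - s| < 1 := by simpa [Real.dist_eq] using ht
      have h2 := abs_sub_abs_le_abs_sub t s
      linarith
    have := h t ht' (a, b) ⟨ha, hb⟩
    rwa [sumWeight, mul_add, Real.exp_add, ← mul_assoc] at this
  · filter_upwards [hB] with b hb t _
    exact hd t (a, b) ⟨ha, hb⟩

/-- Since the weights add, the exponential bound factorises: the factor in `w₂` is integrated out by
the exponential moments of `ρ`, and the factor in `w` survives as the growth bound. -/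
lemma SmoothFamily.integral_right (hG : SmoothFamily (A ×ˢ B) (sumWeight w w₂) k G)
    (hw : ∀ a ∈ A, 0 ≤ w a) (hB : ∀ᵐ b ∂ρ, b ∈ B)
    (hexp : ∀ C : ℝ, Integrable (fun b => Real.exp (C * w₂ b)) ρ) :
    SmoothFamily A w k (fun s a => ∫ b, G s (a, b) ∂ρ) := by
  have hm : ∀ {G : ℝ → α × β → ℝ}, (∀ s, Measurable (G s)) →
      ∀ s, Measurable fun a => ∫ b, G s (a, b) ∂ρ := fun h s =>
    ((h s).stronglyMeasurable.integral_prod_right').measurable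
  induction k generalizing G with
  | zero => exact ⟨hm hG.1, hG.2.integral_right hw hB hexp⟩
  | succ k ih =>
    have hG0 := hG.zero
    obtain ⟨hg0, G', hd, hG'⟩ := hG
    exact ⟨⟨hm hg0.1, hg0.2.integral_right hw hB hexp⟩, _,
      fun s a ha => hG0.hasDerivAt_integral hG'.zero hd hB hexp ha s, ih hG'⟩

/-- One order is lost, since a family of order `0` need not be continuous in the parameter: order `n
+ 1` gives class `C^n`. -/
lemma SmoothFamily.contDiff {a : α} (ha : a ∈ A) (hg : ∀ k, SmoothFamily A w k g) :
    ContDiff ℝ (⊤ : ℕ∞) (fun s => g s a) := by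
  rw [contDiff_infty]
  intro n
  have : ∀ (n : ℕ) {g : ℝ → α → ℝ}, SmoothFamily A w (n + 1) g → ContDiff ℝ n (fun s => g s a) := by
    intro n
    induction n with
    | zero =>
      rintro g ⟨-, g', hd, -⟩
      exact contDiff_zero.mpr (continuous_iff_continuousAt.mpr fun s => (hd s a ha).continuousAt)
    | succ n ih =>
      rintro g ⟨-, g', hd, hg'⟩
      have h1 : deriv (fun s => g s a) = fun s => g' s a := funext fun s => (hd s a ha).deriv
      push_cast
      refine contDiff_succ_iff_deriv.mpr ⟨fun s => (hd s a ha).differentiableAt, by simp, ?_⟩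
      rw [h1]
      exact ih hg'
  exact this n (hg (n + 1))

end SmoothFamily

/-! ### Smooth even functions of a square root -/

/-- Each derivative in `s` brings out a factor `t`, which is why the power `t^j` is carried along.
The weight is zero because `t` is bounded, and `Unit` is a dummy parameter space that fits the
product form of `SmoothFamily.integral_right`. -/
lemma smoothFamily_comp_mul {F : ℝ → ℝ} (hF : ContDiff ℝ (⊤ : ℕ∞) F) (j k : ℕ) :
    SmoothFamily ((Set.univ : Set Unit) ×ˢ Set.Ioc (0 : ℝ) 1) (sumWeight (fun _ => 0) (fun _ => 0)) k
      (fun s p => p.2 ^ j * F (s * p.2)) := by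
  have h0 : ∀ (j : ℕ) {F : ℝ → ℝ}, Continuous F →
      ((∀ s : ℝ, Measurable fun p : Unit × ℝ => p.2 ^ j * F (s * p.2)) ∧
      ExpGrowth ((Set.univ : Set Unit) ×ˢ Set.Ioc (0 : ℝ) 1) (sumWeight (fun _ => 0) (fun _ => 0))
      (fun s p => p.2 ^ j * F (s * p.2))) := by
    intro j F hF
    refine ⟨fun s => (by fun_prop : Continuous _).measurable, fun R => ?_⟩
    obtain ⟨C, hC⟩ := (isCompact_Icc (a := -R) (b := R)).exists_bound_of_continuousOn hF.continuousOn
    refine ⟨|C|, abs_nonneg _, ?_⟩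
    rintro s hs ⟨u, t⟩ ⟨-, ht0, ht1⟩
    simp only [sumWeight, add_zero, mul_zero, Real.exp_zero, mul_one, abs_mul, abs_pow]
    simp only at ht0 ht1
    have hst : |s * t| ≤ R := by
      rw [abs_mul, abs_of_pos ht0]
      nlinarith [abs_nonneg s]
    have h1 : |F (s * t)| ≤ C := hC _ (abs_le.mp hst)
    have h2 : |t| ^ j ≤ 1 := pow_le_one₀ (abs_nonneg _) (by rwa [abs_of_pos ht0])
    have h3 : 0 ≤ |t| ^ j := by positivity
    nlinarith [le_abs_self C, abs_nonneg (F (s * t))]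
  induction k generalizing j F with
  | zero => exact h0 j hF.continuous
  | succ k ih =>
    have hF' : ContDiff ℝ (⊤ : ℕ∞) (deriv F) := (contDiff_infty_iff_deriv.mp hF).2
    refine ⟨h0 j hF.continuous, fun s p => p.2 ^ (j + 1) * deriv F (s * p.2), fun s p _ => ?_,
      ih hF' (j + 1)⟩
    have h1 : HasDerivAt F (deriv F (s * p.2)) (s * p.2) :=
      ((hF.differentiable (by simp)) _).hasDerivAt
    have h2 := (h1.comp s ((hasDerivAt_id s).mul_const p.2)).const_mul (p.2 ^ j)
    convert! h2 using 1
    ring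

/-- Hadamard's lemma for even functions. -/
lemma exists_deriv_eq_mul_of_even {F : ℝ → ℝ} (hF : ContDiff ℝ (⊤ : ℕ∞) F)
    (he : ∀ s, F (-s) = F s) :
    ∃ G : ℝ → ℝ, ContDiff ℝ (⊤ : ℕ∞) G ∧ (∀ s, G (-s) = G s) ∧ ∀ s, deriv F s = 2 * s * G s := by
  have hF' : ContDiff ℝ (⊤ : ℕ∞) (deriv F) := (contDiff_infty_iff_deriv.mp hF).2
  have hF'' : ContDiff ℝ (⊤ : ℕ∞) (deriv (deriv F)) := (contDiff_infty_iff_deriv.mp hF').2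
  have hodd : ∀ s, deriv F (-s) = -deriv F s := by
    intro s
    have h1 : deriv (fun s => F (-s)) s = -deriv F (-s) := deriv_comp_neg F s
    rw [show (fun s => F (-s)) = F from funext he] at h1
    linarith
  have heven : ∀ s, deriv (deriv F) (-s) = deriv (deriv F) s := by
    intro s
    have h1 : deriv (fun s => deriv F (-s)) s = -deriv (deriv F) (-s) := deriv_comp_neg (deriv F) s
    rw [show (fun s => deriv F (-s)) = fun s => -deriv F s from funext hodd, deriv.fun_neg] at h1
    linarith
  -- As `F'` is odd, `F'(0) = 0` and `F'(s) = s ∫₀¹ F''(st) dt`.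
  refine ⟨fun s => (1 / 2) * ∫ t in Set.Ioc (0 : ℝ) 1, deriv (deriv F) (s * t), ?_, ?_, ?_⟩
  · refine contDiff_const.mul ?_
    have := SmoothFamily.contDiff (Set.mem_univ ()) fun k =>
      (smoothFamily_comp_mul hF'' 0 k).integral_right (ρ := volume.restrict (Set.Ioc (0 : ℝ) 1))
        (fun _ _ => le_rfl) (ae_restrict_mem measurableSet_Ioc) (by simp)
    simpa using this
  · intro s
    simp only [neg_mul, heven]
  · intro s
    have h1 : ∀ t ∈ Set.uIcc (0 : ℝ) 1,
        HasDerivAt (fun t => deriv F (s * t)) (s * deriv (deriv F) (s * t)) t := by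
      intro t _
      have h2 : HasDerivAt (deriv F) (deriv (deriv F) (s * t)) (s * t) :=
        ((hF'.differentiable (by simp)) _).hasDerivAt
      have h3 := h2.comp t ((hasDerivAt_id t).const_mul s)
      convert! h3 using 1
      ring
    have hc : Continuous fun t => s * deriv (deriv F) (s * t) := by
      have := hF''.continuous
      fun_prop
    have h4 := intervalIntegral.integral_eq_sub_of_hasDerivAt h1 (hc.intervalIntegrable _ _)
    have h5 : deriv F 0 = 0 := by have := hodd 0; simp at this; linarith
    rw [intervalIntegral.integral_of_le zero_le_one, integral_const_mul] at h4
    simp only [mul_one, mul_zero, h5, sub_zero] at h4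
    rw [← h4]; ring

/-- For `t > 0` the factor `2√t` cancels the derivative of the square root. At `0`, where the square
root is not differentiable, the one-sided derivative is the limit of the derivatives. -/
lemma hasDerivWithinAt_comp_sqrt {F G : ℝ → ℝ} (hF : Differentiable ℝ F) (hG : Continuous G)
    (h : ∀ s, deriv F s = 2 * s * G s) {t : ℝ} (ht : 0 ≤ t) :
    HasDerivWithinAt (fun t => F (√t)) (G (√t)) (Set.Ici 0) t := by
  have hpos : ∀ t : ℝ, 0 < t → HasDerivAt (fun t => F (√t)) (G (√t)) t := by
    intro t ht
    have h1 : HasDerivAt F (2 * √t * G (√t)) (√t) := h (√t) ▸ (hF _).hasDerivAt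
    have h2 := h1.comp t (Real.hasDerivAt_sqrt ht.ne')
    have h3 : √t ≠ 0 := (Real.sqrt_pos.mpr ht).ne'
    convert! h2 using 1
    field_simp
  rcases ht.eq_or_lt with rfl | ht
  · have hc : Continuous fun t => F (√t) := hF.continuous.comp Real.continuous_sqrt
    refine hasDerivWithinAt_Ici_of_tendsto_deriv (s := Set.Ioi 0)
      (fun t ht => (hpos t ht).differentiableAt.differentiableWithinAt) hc.continuousWithinAt
      self_mem_nhdsWithin ?_
    have h1 : Tendsto (fun t => G (√t)) (𝓝[>] 0) (𝓝 (G (√0))) :=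
      ((hG.comp Real.continuous_sqrt).tendsto 0).mono_left nhdsWithin_le_nhds
    refine h1.congr' ?_
    filter_upwards [self_mem_nhdsWithin] with t ht
    exact (hpos t ht).deriv.symm
  · exact (hpos t ht).hasDerivWithinAt

/-- Whitney's theorem: a smooth even function is a smooth function of the square. -/
lemma contDiffOn_comp_sqrt_of_even {F : ℝ → ℝ} (hF : ContDiff ℝ (⊤ : ℕ∞) F)
    (he : ∀ s, F (-s) = F s) : ContDiffOn ℝ (⊤ : ℕ∞) (fun t => F (√t)) (Set.Ici 0) := by
  rw [contDiffOn_infty]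
  intro n
  induction n generalizing F with
  | zero => exact contDiffOn_zero.mpr (hF.continuous.comp Real.continuous_sqrt).continuousOn
  | succ n ih =>
    -- The derivative of `F(√t)` is `G(√t)` with `G` again smooth and even, so the induction applies
    -- to `G`.
    obtain ⟨G, hG, hGe, hFG⟩ := exists_deriv_eq_mul_of_even hF he
    have hd : ∀ t ∈ Set.Ici (0 : ℝ), HasDerivWithinAt (fun t => F (√t)) (G (√t)) (Set.Ici 0) t :=
      fun t ht => hasDerivWithinAt_comp_sqrt (hF.differentiable (by simp)) hG.continuous hFG ht
    push_cast
    refine (contDiffOn_succ_iff_derivWithin (uniqueDiffOn_Ici 0)).mpr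
      ⟨fun t ht => (hd t ht).differentiableWithinAt, by simp, (ih hG hGe).congr fun t ht => ?_⟩
    exact (hd t ht).derivWithin (uniqueDiffOn_Ici 0 t ht)

/-! ### The joint law of the input and the output -/

section Bayes

set_option linter.unusedSectionVars false

variable (ν : Measure ℂ) [IsProbabilityMeasure ν] (g : ℂ)

/-- The density of the law of `g x + n` with respect to the law of the noise `n`, where `x` has
law `ν`. -/
noncomputable def outputDensity (y : ℂ) : ℝ := ∫ x, Real.exp (tilt y (g * x)) ∂ν

/-- The numerator of Bayes' formula for the conditional mean of the input. -/
noncomputable def inputMoment (y : ℂ) : ℂ := ∫ x, Real.exp (tilt y (g * x)) • x ∂ν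

/-- Bayes' formula for the conditional mean of the input. -/
noncomputable def posteriorMean (y : ℂ) : ℂ := (outputDensity ν g y)⁻¹ • inputMoment ν g y

/-- The joint law of `(x, g x + n)`, where `x` has law `ν`. -/
noncomputable def jointLaw : Measure (ℂ × ℂ) :=
  (ν.prod stdGaussian).withDensity fun p => ENNReal.ofReal (Real.exp (tilt p.2 (g * p.1)))

/-- For each fixed `x` this is the Cameron–Martin shift by `g x`. -/
lemma jointLaw_eq_map :
    jointLaw ν g = (ν.prod stdGaussian).map (fun p => (p.1, g * p.1 + p.2)) := by
  refine Measure.ext_of_lintegral _ fun f hf => ?_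
  rw [lintegral_map hf (by fun_prop), jointLaw,
    lintegral_withDensity_eq_lintegral_mul _ (by fun_prop) hf,
    lintegral_prod _ (by fun_prop), lintegral_prod _ (by fun_prop)]
  refine lintegral_congr fun x => ?_
  exact (lintegral_stdGaussian_add (g * x) (f := fun z => f (x, z)) (by fun_prop)).symm

instance : IsProbabilityMeasure (jointLaw ν g) := by
  rw [jointLaw_eq_map]
  exact Measure.isProbabilityMeasure_map (by fun_prop)

variable {ν g}

lemma integrable_jointLaw {E : Type*} [NormedAddCommGroup E] [NormedSpace ℝ E] {f : ℂ × ℂ → E} :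
    Integrable f (jointLaw ν g) ↔
      Integrable (fun p => Real.exp (tilt p.2 (g * p.1)) • f p) (ν.prod stdGaussian) := by
  rw [jointLaw, integrable_withDensity_iff_integrable_smul' (by fun_prop) (by simp)]
  simp [ENNReal.toReal_ofReal, Real.exp_nonneg]

lemma integral_jointLaw {E : Type*} [NormedAddCommGroup E] [NormedSpace ℝ E] (f : ℂ × ℂ → E) :
    ∫ p, f p ∂jointLaw ν g =
      ∫ p, Real.exp (tilt p.2 (g * p.1)) • f p ∂(ν.prod stdGaussian) := by
  rw [jointLaw, integral_withDensity_eq_integral_toReal_smul (by fun_prop) (by simp)]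
  simp [ENNReal.toReal_ofReal, Real.exp_nonneg]

lemma integrable_exp_tilt (y : ℂ) : Integrable (fun x => Real.exp (tilt y (g * x))) ν := by
  refine Integrable.of_bound (by fun_prop : Measurable _).aestronglyMeasurable (Real.exp (‖y‖ ^ 2)) (ae_of_all _ fun x => ?_)
  rw [Real.norm_of_nonneg (Real.exp_pos _).le]
  exact Real.exp_le_exp.mpr (tilt_le _ _)

lemma outputDensity_pos (y : ℂ) : 0 < outputDensity ν g y :=
  integral_exp_pos (integrable_exp_tilt y)

@[fun_prop]
lemma measurable_outputDensity : Measurable (outputDensity ν g) := by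
  have : StronglyMeasurable fun p : ℂ × ℂ => Real.exp (tilt p.1 (g * p.2)) :=
    (by fun_prop : Measurable _).stronglyMeasurable
  exact this.integral_prod_right'.measurable

@[fun_prop]
lemma measurable_inputMoment : Measurable (inputMoment ν g) := by
  have : StronglyMeasurable fun p : ℂ × ℂ => Real.exp (tilt p.1 (g * p.2)) • p.2 :=
    (by fun_prop : Measurable _).stronglyMeasurable
  exact this.integral_prod_right'.measurable

@[fun_prop]
lemma measurable_posteriorMean : Measurable (posteriorMean ν g) := by
  unfold posteriorMean; fun_prop

lemma jointLaw_map_snd :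
    (jointLaw ν g).map Prod.snd =
      stdGaussian.withDensity fun y => ENNReal.ofReal (outputDensity ν g y) := by
  refine Measure.ext_of_lintegral _ fun f hf => ?_
  rw [lintegral_map hf (by fun_prop), jointLaw,
    lintegral_withDensity_eq_lintegral_mul _ (by fun_prop) (by fun_prop),
    lintegral_withDensity_eq_lintegral_mul _ (by fun_prop) hf, lintegral_prod_symm' _ (by fun_prop)]
  refine lintegral_congr fun y => ?_
  simp only [Pi.mul_apply]
  rw [lintegral_mul_const _ (by fun_prop), outputDensity,
    ofReal_integral_eq_lintegral_ofReal (integrable_exp_tilt y)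
      (ae_of_all _ fun x => (Real.exp_pos _).le)]

lemma integrable_comp_snd_jointLaw {E : Type*} [NormedAddCommGroup E] [NormedSpace ℝ E]
    {f : ℂ → E} (hf : AEStronglyMeasurable f ((jointLaw ν g).map Prod.snd)) :
    Integrable (fun p => f p.2) (jointLaw ν g) ↔
      Integrable (fun y => outputDensity ν g y • f y) stdGaussian := by
  have h := integrable_map_measure (μ := jointLaw ν g) (f := Prod.snd) hf (by fun_prop)
  rw [show (fun p : ℂ × ℂ => f p.2) = f ∘ Prod.snd from rfl, ← h, jointLaw_map_snd,
    integrable_withDensity_iff_integrable_smul' (by fun_prop) (by simp)]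
  simp [ENNReal.toReal_ofReal, (outputDensity_pos _).le]

lemma integral_comp_snd_jointLaw {E : Type*} [NormedAddCommGroup E] [NormedSpace ℝ E]
    {f : ℂ → E} (hf : AEStronglyMeasurable f ((jointLaw ν g).map Prod.snd)) :
    ∫ p, f p.2 ∂jointLaw ν g = ∫ y, outputDensity ν g y • f y ∂stdGaussian := by
  rw [← integral_map (φ := Prod.snd) (by fun_prop) hf, jointLaw_map_snd,
    integral_withDensity_eq_integral_toReal_smul (by fun_prop) (by simp)]
  simp [ENNReal.toReal_ofReal, (outputDensity_pos _).le]

variable (ν g) in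
/-- The normalised MMSE as a function of the (complex) gain. -/
noncomputable def mmseFun : ℝ :=
  ∫ x, ‖x‖ ^ 2 ∂ν - ∫ y, ‖inputMoment ν g y‖ ^ 2 / outputDensity ν g y ∂stdGaussian

variable (ν g) in
/-- The mutual information as a function of the (complex) gain. -/
noncomputable def infoFun : ℝ :=
  ‖g‖ ^ 2 * ∫ x, ‖x‖ ^ 2 ∂ν -
    ∫ p, Real.log (outputDensity ν g (g * p.1 + p.2)) ∂(ν.prod stdGaussian)

/-! ### Conditional mean, mean-square error and mutual information at a fixed gain -/

variable {Ω : Type*} [MeasurableSpace Ω] {P : Measure Ω} [IsProbabilityMeasure P] {x n : Ω → ℂ}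

lemma map_prodMk_eq_jointLaw (hx : Measurable x) (hn : Measurable n) (hind : IndepFun x n P)
    (hxl : P.map x = ν) (hnl : P.map n = stdGaussian) :
    P.map (fun ω => (x ω, g * x ω + n ω)) = jointLaw ν g := by
  rw [jointLaw_eq_map, ← hxl, ← hnl,
    ← (indepFun_iff_map_prod_eq_prod_map_map hx.aemeasurable hn.aemeasurable).mp hind,
    Measure.map_map (by fun_prop) (by fun_prop)]
  rfl

lemma integrable_input (hν : Integrable (fun x : ℂ => x) ν) :
    Integrable (fun p : ℂ × ℂ => p.1) (jointLaw ν g) := by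
  rw [jointLaw_eq_map, integrable_map_measure (by fun_prop) (by fun_prop)]
  exact hν.comp_fst stdGaussian

/-- By Fubini both sides equal the integral of `inputMoment` over `B` against the noise law. This is
the defining property of the conditional mean, tested on output events. -/
lemma integral_input_eq_integral_posteriorMean (hν : Integrable (fun x : ℂ => x) ν)
    {B : Set ℂ} (hB : MeasurableSet B) :
    Integrable (fun p : ℂ × ℂ => B.indicator (posteriorMean ν g) p.2) (jointLaw ν g) ∧
    ∫ p, B.indicator (posteriorMean ν g) p.2 ∂jointLaw ν g =
      ∫ p, B.indicator (fun _ => p.1) p.2 ∂jointLaw ν g := by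
  have hmeas : Measurable (B.indicator (posteriorMean ν g)) :=
    measurable_posteriorMean.indicator hB
  have h1 : ∀ y, outputDensity ν g y • B.indicator (posteriorMean ν g) y =
      B.indicator (inputMoment ν g) y := by
    intro y
    by_cases hy : y ∈ B
    · simp [hy, posteriorMean, (outputDensity_pos y).ne']
    · simp [hy]
  have h2 : ∀ x y, Real.exp (tilt y (g * x)) • B.indicator (fun _ => x) y =
      B.indicator (fun y => Real.exp (tilt y (g * x)) • x) y := by
    intro x y
    by_cases hy : y ∈ B <;> simp [hy]
  have h3 : ∀ y, ∫ x, B.indicator (fun y => Real.exp (tilt y (g * x)) • x) y ∂ν =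
      B.indicator (inputMoment ν g) y := by
    intro y
    by_cases hy : y ∈ B <;> simp [hy, inputMoment]
  have h4 : Integrable (fun p : ℂ × ℂ => B.indicator (fun _ => p.1) p.2) (jointLaw ν g) := by
    have : (fun p : ℂ × ℂ => B.indicator (fun _ => p.1) p.2) =
        (Prod.snd ⁻¹' B).indicator (fun p : ℂ × ℂ => p.1) := by
      ext p
      by_cases hy : p.2 ∈ B <;> simp [hy]
    rw [this]
    exact (integrable_input hν).indicator (measurable_snd hB)
  rw [integrable_jointLaw] at h4
  simp_rw [h2] at h4
  rw [integrable_comp_snd_jointLaw hmeas.aestronglyMeasurable,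
    integral_comp_snd_jointLaw hmeas.aestronglyMeasurable, integral_jointLaw]
  simp_rw [h1, h2]
  constructor
  · have := h4.integral_prod_right
    simpa only [h3] using this
  · rw [integral_prod_symm _ h4]
    simp_rw [h3]

lemma condExp_input_ae_eq (hx : Measurable x) (hn : Measurable n) (hind : IndepFun x n P)
    (hxl : P.map x = ν) (hnl : P.map n = stdGaussian) (hν : Integrable (fun x : ℂ => x) ν) :
    (fun ω => posteriorMean ν g (g * x ω + n ω)) =ᵐ[P]
      P[x | MeasurableSpace.comap (fun ω => g * x ω + n ω) inferInstance] := by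
  have hY : Measurable (fun ω => g * x ω + n ω) := by fun_prop
  have hκ := map_prodMk_eq_jointLaw (g := g) hx hn hind hxl hnl
  have hxi : Integrable x P := by
    have := hν
    rw [← hxl, integrable_map_measure (by fun_prop) (by fun_prop)] at this
    exact this
  have key : ∀ B : Set ℂ, MeasurableSet B →
      IntegrableOn (fun ω => posteriorMean ν g (g * x ω + n ω)) ((fun ω => g * x ω + n ω) ⁻¹' B) P ∧
      ∫ ω in (fun ω => g * x ω + n ω) ⁻¹' B, posteriorMean ν g (g * x ω + n ω) ∂P =
        ∫ ω in (fun ω => g * x ω + n ω) ⁻¹' B, x ω ∂P := by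
    intro B hB
    obtain ⟨h1, h2⟩ := integral_input_eq_integral_posteriorMean (g := g) hν hB
    have hm1 : Measurable fun p : ℂ × ℂ => B.indicator (posteriorMean ν g) p.2 :=
      (measurable_posteriorMean.indicator hB).comp measurable_snd
    have hm2 : Measurable fun p : ℂ × ℂ => B.indicator (fun _ => p.1) p.2 := by
      have : (fun p : ℂ × ℂ => B.indicator (fun _ => p.1) p.2) =
          (Prod.snd ⁻¹' B).indicator (fun p : ℂ × ℂ => p.1) := by
        ext p
        by_cases hy : p.2 ∈ B <;> simp [hy]
      rw [this]
      exact measurable_fst.indicator (measurable_snd hB)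
    rw [← hκ, integrable_map_measure hm1.aestronglyMeasurable (by fun_prop)] at h1
    rw [← hκ, integral_map (by fun_prop) hm1.aestronglyMeasurable,
      integral_map (by fun_prop) hm2.aestronglyMeasurable] at h2
    rw [← integrable_indicator_iff (hY hB), ← integral_indicator (hY hB),
      ← integral_indicator (hY hB)]
    exact ⟨h1, h2⟩
  refine ae_eq_condExp_of_forall_setIntegral_eq hY.comap_le hxi ?_ ?_ ?_
  · rintro _ ⟨B, hB, rfl⟩ -
    exact (key B hB).1
  · rintro _ ⟨B, hB, rfl⟩ -
    exact (key B hB).2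
  · exact (measurable_posteriorMean.comp (comap_measurable _)).stronglyMeasurable.aestronglyMeasurable

lemma integral_re_input_mul_posteriorMean
    (hint : Integrable (fun p : ℂ × ℂ => p.1 * conj (posteriorMean ν g p.2)) (jointLaw ν g)) :
    ∫ p, (p.1 * conj (posteriorMean ν g p.2)).re ∂jointLaw ν g =
      ∫ y, ‖inputMoment ν g y‖ ^ 2 / outputDensity ν g y ∂stdGaussian := by
  have h2 : ∫ p, p.1 * conj (posteriorMean ν g p.2) ∂jointLaw ν g =
      ((∫ y, ‖inputMoment ν g y‖ ^ 2 / outputDensity ν g y ∂stdGaussian : ℝ) : ℂ) := by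
    rw [integral_jointLaw, integral_prod_symm _ (integrable_jointLaw.mp hint),
      ← integral_complex_ofReal]
    refine integral_congr_ae (ae_of_all _ fun y => ?_)
    simp only [← smul_mul_assoc]
    rw [integral_mul_const]
    change inputMoment ν g y * conj (posteriorMean ν g y) = _
    rw [posteriorMean, Complex.real_smul, map_mul, Complex.conj_ofReal, mul_left_comm,
      Complex.mul_conj, Complex.normSq_eq_norm_sq]
    push_cast
    field_simp
  have h3 := integral_re hint
  simp only [RCLike.re_eq_complex_re] at h3
  rw [h3, h2, Complex.ofReal_re]

lemma integral_norm_sub_condExp_sq (hx : Measurable x) (hn : Measurable n) (hind : IndepFun x n P)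
    (hxl : P.map x = ν) (hnl : P.map n = stdGaussian) (hν : MemLp (fun x : ℂ => x) 2 ν) :
    ∫ ω, ‖x ω - (P[x | MeasurableSpace.comap (fun ω => g * x ω + n ω) inferInstance]) ω‖ ^ 2 ∂P =
      mmseFun ν g := by
  have hY : Measurable (fun ω => g * x ω + n ω) := by fun_prop
  have hκ := map_prodMk_eq_jointLaw (g := g) hx hn hind hxl hnl
  have hce := condExp_input_ae_eq (g := g) hx hn hind hxl hnl (hν.integrable one_le_two)
  have hx2 : MemLp x 2 P := by
    have := hν
    rw [← hxl, memLp_map_measure_iff (by fun_prop) (by fun_prop)] at this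
    exact this
  -- Square integrability is inherited from `x`, since conditional expectation preserves `L²`.
  have hc2 : MemLp (fun ω => posteriorMean ν g (g * x ω + n ω)) 2 P :=
    (hx2.condExp one_le_two).ae_eq hce.symm
  set c : Ω → ℂ := fun ω => posteriorMean ν g (g * x ω + n ω) with hc
  have hnn : ∀ y, ‖posteriorMean ν g y‖ ^ 2 * outputDensity ν g y =
      ‖inputMoment ν g y‖ ^ 2 / outputDensity ν g y := by
    intro y
    have := outputDensity_pos (ν := ν) (g := g) y
    rw [posteriorMean, norm_smul, Real.norm_of_nonneg (inv_nonneg.mpr this.le)]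
    field_simp
  have hcc : ∫ ω, ‖c ω‖ ^ 2 ∂P =
      ∫ y, ‖inputMoment ν g y‖ ^ 2 / outputDensity ν g y ∂stdGaussian := by
    have hm : Measurable fun y => ‖posteriorMean ν g y‖ ^ 2 := by fun_prop
    have := integral_comp_snd_jointLaw (ν := ν) (g := g) hm.aestronglyMeasurable
    rw [← hκ, integral_map (f := fun p : ℂ × ℂ => ‖posteriorMean ν g p.2‖ ^ 2) (by fun_prop)
      (by fun_prop : Measurable _).aestronglyMeasurable] at this
    rw [hc, this]
    exact integral_congr_ae (ae_of_all _ fun y => by simp only [smul_eq_mul, ← hnn y]; ring)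
  have hcm : Measurable c := by rw [hc]; fun_prop
  have hconjm : Measurable (fun z : ℂ => conj z) := Complex.continuous_conj.measurable
  have hxc : Integrable (fun ω => x ω * conj (c ω)) P := by
    refine (hx2.integrable_mul hc2.norm.ofReal).mono (by fun_prop) (ae_of_all _ fun ω => ?_)
    simp
  -- Orthogonality: `E Re(x conj c) = E|c|²`, so the expanded square collapses to `E|x|² - E|c|²`.
  have hcross : ∫ ω, (x ω * conj (c ω)).re ∂P =
      ∫ y, ‖inputMoment ν g y‖ ^ 2 / outputDensity ν g y ∂stdGaussian := by
    have hm : Measurable fun p : ℂ × ℂ => p.1 * conj (posteriorMean ν g p.2) := by fun_prop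
    have hint : Integrable (fun p : ℂ × ℂ => p.1 * conj (posteriorMean ν g p.2)) (jointLaw ν g) := by
      rw [← hκ, integrable_map_measure hm.aestronglyMeasurable (by fun_prop)]
      exact hxc
    have hm' : Measurable fun p : ℂ × ℂ => (p.1 * conj (posteriorMean ν g p.2)).re :=
      Complex.continuous_re.measurable.comp hm
    rw [← integral_re_input_mul_posteriorMean hint, ← hκ,
      integral_map (by fun_prop) hm'.aestronglyMeasurable]
  have hxx : ∫ ω, ‖x ω‖ ^ 2 ∂P = ∫ z, ‖z‖ ^ 2 ∂ν := by
    rw [← hxl, integral_map (by fun_prop) (by fun_prop)]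
  calc _ = ∫ ω, (‖x ω‖ ^ 2 - 2 * (x ω * conj (c ω)).re + ‖c ω‖ ^ 2) ∂P := by
        refine integral_congr_ae ?_
        filter_upwards [hce] with ω hω
        rw [← hω, ← Complex.normSq_eq_norm_sq, Complex.normSq_sub, Complex.normSq_eq_norm_sq,
          Complex.normSq_eq_norm_sq]
        ring
    _ = _ := by
        have i1 : Integrable (fun ω => ‖x ω‖ ^ 2) P := hx2.integrable_norm_pow two_ne_zero
        have i2 : Integrable (fun ω => ‖c ω‖ ^ 2) P := hc2.integrable_norm_pow two_ne_zero
        have i3 : Integrable (fun ω => 2 * (x ω * conj (c ω)).re) P := hxc.re.const_mul 2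
        have i4 : Integrable (fun ω => ‖x ω‖ ^ 2 - 2 * (x ω * conj (c ω)).re) P := i1.sub i3
        rw [integral_add i4 i2, integral_sub i1 i3, integral_const_mul, hcross, hcc, hxx,
          mmseFun]
        ring

/-- The log-density against the product of the marginals is `tilt y (g x) - log q(y)`. At `y = g x +
z` the tilt equals `|g|²|x|²` plus a cross term that is linear in the centred noise `z` and averages
to zero. -/
lemma klDiv_jointLaw (hν : MemLp (fun x : ℂ => x) 2 ν)
    (hlog : Integrable (fun p => Real.log (outputDensity ν g (g * p.1 + p.2)))
      (ν.prod stdGaussian)) :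
    InformationTheory.klDiv (jointLaw ν g) (ν.prod ((jointLaw ν g).map Prod.snd)) =
      ENNReal.ofReal (infoFun ν g) := by
  set π := ν.prod ((jointLaw ν g).map Prod.snd) with hπ
  have : IsProbabilityMeasure ((jointLaw ν g).map Prod.snd) :=
    Measure.isProbabilityMeasure_map (by fun_prop)
  have hπ2 : π = (ν.prod stdGaussian).withDensity
      fun p => ENNReal.ofReal (outputDensity ν g p.2) := by
    have : SFinite (stdGaussian.withDensity fun y => ENNReal.ofReal (outputDensity ν g y)) := by
      rw [← jointLaw_map_snd]; infer_instance
    rw [hπ, jointLaw_map_snd, prod_withDensity_right (by fun_prop)]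
  have hjoint : jointLaw ν g = π.withDensity fun p =>
      ENNReal.ofReal (Real.exp (tilt p.2 (g * p.1)) / outputDensity ν g p.2) := by
    rw [hπ2, ← withDensity_mul _ (by fun_prop) (by fun_prop), jointLaw]
    congr 1 with p
    have := outputDensity_pos (ν := ν) (g := g) p.2
    simp only [Pi.mul_apply]
    rw [← ENNReal.ofReal_mul this.le]
    congr 1
    field_simp
  have hac : jointLaw ν g ≪ π := by
    conv_lhs => rw [hjoint]
    exact withDensity_absolutelyContinuous _ _
  have hrn : (jointLaw ν g).rnDeriv π =ᵐ[π] fun p =>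
      ENNReal.ofReal (Real.exp (tilt p.2 (g * p.1)) / outputDensity ν g p.2) := by
    conv_lhs => rw [hjoint]
    exact Measure.rnDeriv_withDensity _ (by fun_prop)
  have hllr : llr (jointLaw ν g) π =ᵐ[jointLaw ν g] fun p =>
      tilt p.2 (g * p.1) - Real.log (outputDensity ν g p.2) := by
    filter_upwards [hac.ae_le hrn] with p hp
    have := outputDensity_pos (ν := ν) (g := g) p.2
    rw [llr, hp, ENNReal.toReal_ofReal (by positivity), Real.log_div (Real.exp_ne_zero _) this.ne',
      Real.log_exp]
  have hshift : ∀ x z : ℂ, tilt (g * x + z) (g * x) = ‖g‖ ^ 2 * ‖x‖ ^ 2 +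
      2 * (z * conj (g * x)).re := by
    intro x z
    rw [tilt, add_mul, Complex.add_re, Complex.mul_conj, Complex.ofReal_re,
      Complex.normSq_eq_norm_sq, norm_mul]
    ring
  have i1 : Integrable (fun p : ℂ × ℂ => ‖g‖ ^ 2 * ‖p.1‖ ^ 2) (ν.prod stdGaussian) :=
    ((hν.integrable_norm_pow two_ne_zero).const_mul (‖g‖ ^ 2)).comp_fst stdGaussian
  have i0 : Integrable (fun z : ℂ => z) stdGaussian := by
    simpa using integrable_pow_mul_conj_pow_stdGaussian 1 0
  have i2 : Integrable (fun p : ℂ × ℂ => conj (g * p.1) * p.2) (ν.prod stdGaussian) := by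
    refine Integrable.mul_prod (f := fun x => conj (g * x)) (g := fun z : ℂ => z) ?_ i0
    refine ((hν.integrable one_le_two).const_mul g).mono ?_ (ae_of_all _ fun x => by simp)
    exact (by fun_prop : Continuous fun x : ℂ => conj (g * x)).aestronglyMeasurable
  have i3 : Integrable (fun p : ℂ × ℂ => 2 * (p.2 * conj (g * p.1)).re) (ν.prod stdGaussian) :=
    (i2.re.const_mul 2).congr (ae_of_all _ fun p => by
      simp only [RCLike.re_eq_complex_re, mul_comm p.2])
  have e3 : ∫ p : ℂ × ℂ, 2 * (p.2 * conj (g * p.1)).re ∂(ν.prod stdGaussian) = 0 := by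
    have h1 := integral_re i2
    rw [integral_prod_mul (fun x => conj (g * x)) (fun z : ℂ => z)] at h1
    have h2 : ∫ z : ℂ, z ∂stdGaussian = 0 := by
      simpa using integral_pow_mul_conj_pow_stdGaussian 1 0
    rw [h2, mul_zero] at h1
    simp only [RCLike.re_eq_complex_re, Complex.zero_re] at h1
    rw [integral_const_mul]
    simp_rw [mul_comm _ (conj _)]
    rw [h1, mul_zero]
  have hm : Measurable fun p : ℂ × ℂ => tilt p.2 (g * p.1) - Real.log (outputDensity ν g p.2) := by
    fun_prop
  have hint : Integrable (fun p : ℂ × ℂ =>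
      tilt p.2 (g * p.1) - Real.log (outputDensity ν g p.2)) (jointLaw ν g) := by
    rw [jointLaw_eq_map, integrable_map_measure (by fun_prop) (by fun_prop)]
    simp only [Function.comp_def, hshift]
    exact (i1.add i3).sub hlog
  rw [InformationTheory.klDiv_of_ac_of_integrable hac ((integrable_congr hllr).mpr hint),
    integral_congr_ae hllr]
  -- The mass correction in `klDiv` vanishes, both measures being probabilities.
  simp only [probReal_univ, add_sub_cancel_right]
  congr 1
  rw [jointLaw_eq_map, integral_map (by fun_prop) (by fun_prop)]
  simp only [hshift]
  have i4 : Integrable (fun p : ℂ × ℂ => ‖g‖ ^ 2 * ‖p.1‖ ^ 2 + 2 * (p.2 * conj (g * p.1)).re)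
      (ν.prod stdGaussian) := i1.add i3
  rw [integral_sub i4 hlog, integral_add i1 i3, e3, add_zero, integral_const_mul, infoFun]
  congr 2
  exact integral_fun_fst (fun x : ℂ => ‖x‖ ^ 2) |>.trans (by simp)

/-! ### Reduction to a real gain -/

lemma tilt_rotate {u : ℂ} (hu : ‖u‖ = 1) (y w : ℂ) : tilt y (u * w) = tilt (conj u * y) w := by
  rw [tilt, tilt, norm_mul, hu, one_mul, map_mul, ← mul_assoc, mul_comm y]

lemma outputDensity_rotate {u : ℂ} (hu : ‖u‖ = 1) (y : ℂ) :
    outputDensity ν (u * g) y = outputDensity ν g (conj u * y) := by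
  simp only [outputDensity, mul_assoc, tilt_rotate hu]

lemma inputMoment_rotate {u : ℂ} (hu : ‖u‖ = 1) (y : ℂ) :
    inputMoment ν (u * g) y = inputMoment ν g (conj u * y) := by
  simp only [inputMoment, mul_assoc, tilt_rotate hu]

lemma mmseFun_rotate {u : ℂ} (hu : ‖u‖ = 1) : mmseFun ν (u * g) = mmseFun ν g := by
  have hu' : ‖conj u‖ = 1 := by simpa using hu
  rw [mmseFun, mmseFun]
  simp_rw [inputMoment_rotate hu, outputDensity_rotate hu]
  have h := integral_map (μ := stdGaussian) (φ := fun z => conj u * z)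
    (f := fun y => ‖inputMoment ν g y‖ ^ 2 / outputDensity ν g y) (by fun_prop)
    (by fun_prop : Measurable _).aestronglyMeasurable
  rw [← h, map_const_mul_stdGaussian hu']

lemma log_outputDensity_rotate {u : ℂ} (hu : ‖u‖ = 1) :
    (Integrable (fun p => Real.log (outputDensity ν g (g * p.1 + p.2))) (ν.prod stdGaussian) →
      Integrable (fun p => Real.log (outputDensity ν (u * g) (u * g * p.1 + p.2)))
        (ν.prod stdGaussian)) ∧ infoFun ν (u * g) = infoFun ν g := by
  have hu' : ‖conj u‖ = 1 := by simpa using hu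
  have hm : Measurable fun p : ℂ × ℂ => Real.log (outputDensity ν g (g * p.1 + p.2)) := by
    fun_prop
  have hmap : (ν.prod stdGaussian).map (fun p => (p.1, conj u * p.2)) = ν.prod stdGaussian := by
    have := Measure.map_prod_map ν stdGaussian measurable_id
      (by fun_prop : Measurable fun z : ℂ => conj u * z)
    rw [Measure.map_id, map_const_mul_stdGaussian hu'] at this
    exact this.symm
  have h1 : ∀ p : ℂ × ℂ, Real.log (outputDensity ν (u * g) (u * g * p.1 + p.2)) =
      Real.log (outputDensity ν g (g * p.1 + conj u * p.2)) := by
    intro p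
    have h2 : conj u * u = 1 := by
      rw [mul_comm, Complex.mul_conj, Complex.normSq_eq_norm_sq, hu]; norm_num
    rw [outputDensity_rotate hu]
    congr 2
    linear_combination (g * p.1) * h2
  simp only [infoFun, h1, norm_mul, hu, one_mul]
  constructor
  · intro h
    rw [← hmap, integrable_map_measure hm.aestronglyMeasurable (by fun_prop)] at h
    exact h
  · congr 1
    have h3 := integral_map (μ := ν.prod stdGaussian) (φ := fun p => (p.1, conj u * p.2))
      (by fun_prop) hm.aestronglyMeasurable
    rw [hmap] at h3
    exact h3.symm

/-- The phase of `h₀` is split off, with `u = 1` when `h₀ = 0`. No sign condition on `snr` is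
needed, as the real square root of a negative number is `0`. -/
lemma exists_gain_eq (h₀ : ℂ) (snr : ℝ) :
    ∃ u : ℂ, ‖u‖ = 1 ∧ ((√snr : ℝ) : ℂ) * h₀ = u * ((√(‖h₀‖ ^ 2 * snr) : ℝ) : ℂ) := by
  rcases eq_or_ne h₀ 0 with rfl | h
  · exact ⟨1, by simp, by simp⟩
  · have hn : (‖h₀‖ : ℂ) ≠ 0 := by simpa using h
    refine ⟨h₀ / ‖h₀‖, by simp [h], ?_⟩
    rw [Real.sqrt_mul (by positivity), Real.sqrt_sq (norm_nonneg _)]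
    push_cast
    field_simp

lemma condMmse_eq (hx : Measurable x) (hn : Measurable n) (hind : IndepFun x n P)
    (hxl : P.map x = ν) (hnl : P.map n = stdGaussian) (hν : MemLp (fun x : ℂ => x) 2 ν)
    (h₀ : ℂ) (snr : ℝ) :
    condMmse P x n h₀ snr = ‖h₀‖ ^ 2 * mmseFun ν ((√(‖h₀‖ ^ 2 * snr) : ℝ) : ℂ) := by
  obtain ⟨u, hu, hg⟩ := exists_gain_eq h₀ snr
  have h1 := integral_norm_sub_condExp_sq (g := ((√snr : ℝ) : ℂ) * h₀) hx hn hind hxl hnl hν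
  rw [hg, mmseFun_rotate hu] at h1
  rw [← h1, ← integral_const_mul, ← hg]
  refine integral_congr_ae ?_
  have h2 : P[fun ω' => h₀ * x ω' | MeasurableSpace.comap (output x n h₀ snr) inferInstance] =ᵐ[P]
      h₀ • P[x | MeasurableSpace.comap (output x n h₀ snr) inferInstance] :=
    condExp_smul h₀ x _
  filter_upwards [h2] with ω hω
  rw [hω, Pi.smul_apply, smul_eq_mul, ← mul_sub, norm_mul, mul_pow]
  rfl

lemma condMutualInfo_eq (hx : Measurable x) (hn : Measurable n) (hind : IndepFun x n P)
    (hxl : P.map x = ν) (hnl : P.map n = stdGaussian) (hν : MemLp (fun x : ℂ => x) 2 ν)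
    (hlog : ∀ s : ℝ, Integrable (fun p => Real.log (outputDensity ν s (s * p.1 + p.2)))
      (ν.prod stdGaussian)) (h₀ : ℂ) (snr : ℝ) :
    condMutualInfo P x n h₀ snr =
      ENNReal.ofReal (infoFun ν ((√(‖h₀‖ ^ 2 * snr) : ℝ) : ℂ)) := by
  obtain ⟨u, hu, hg⟩ := exists_gain_eq h₀ snr
  obtain ⟨h1, h2⟩ := log_outputDensity_rotate (ν := ν)
    (g := ((√(‖h₀‖ ^ 2 * snr) : ℝ) : ℂ)) hu
  have hκ := map_prodMk_eq_jointLaw (g := ((√snr : ℝ) : ℂ) * h₀) hx hn hind hxl hnl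
  have hκ2 : P.map (output x n h₀ snr) =
      (jointLaw ν (((√snr : ℝ) : ℂ) * h₀)).map Prod.snd := by
    rw [← hκ, Measure.map_map (by fun_prop) (by fun_prop)]
    rfl
  rw [condMutualInfo, hκ2, hxl, ← h2, ← hg, ← klDiv_jointLaw hν (by rw [hg]; exact h1 (hlog _)),
    ← hκ]
  rfl

end Bayes

/-! ### Inputs of bounded support -/

section Quadratic

set_option linter.unusedSectionVars false

variable {α β : Type*} [MeasurableSpace α] [MeasurableSpace β] {A : Set α} {w : α → ℝ}

lemma abs_quadratic_le {C R s u v W : ℝ} (hs : |s| ≤ R) (hu : |u| ≤ C * W) (hv : |v| ≤ C) :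
    |s * u + s ^ 2 * v| ≤ R * C * W + R ^ 2 * C := by
  have hR : 0 ≤ R := (abs_nonneg s).trans hs
  refine (abs_add_le _ _).trans (add_le_add ?_ ?_)
  · rw [abs_mul, mul_assoc]
    exact mul_le_mul hs hu (abs_nonneg _) hR
  · rw [abs_mul, abs_pow]
    exact mul_le_mul (pow_le_pow_left₀ (abs_nonneg s) hs 2) hv (abs_nonneg _) (by positivity)

lemma expGrowth_of_le_exp (hw : ∀ a ∈ A, 0 ≤ w a) {C : ℝ} (hC : 0 ≤ C) {g : ℝ → α → ℝ}
    (h : ∀ R s, |s| ≤ R → ∀ a ∈ A, |g s a| ≤ Real.exp (R * C * w a + R ^ 2 * C)) :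
    ExpGrowth A w g := by
  intro R
  set R' := max R 0 with hR'
  have hR0 : 0 ≤ R' := le_max_right _ _
  refine ⟨Real.exp (R' ^ 2 * C) + R' * C, by positivity, fun s hs a ha => ?_⟩
  refine (h R' s (hs.trans (le_max_left _ _)) a ha).trans ?_
  have hwa := hw a ha
  have hRC : 0 ≤ R' * C := by positivity
  have hpos := Real.exp_pos (R' ^ 2 * C)
  rw [Real.exp_add, mul_comm]
  gcongr <;> linarith

lemma smoothFamily_of_le_weight (hw : ∀ a ∈ A, 0 ≤ w a) {u : α → ℝ} (hum : Measurable u) {C : ℝ}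
    (hC : 0 ≤ C) (hu : ∀ a ∈ A, |u a| ≤ C * w a) (k : ℕ) : SmoothFamily A w k (fun _ a => u a) := by
  refine smoothFamily_of_le hum (C := C + 1) (by positivity) fun a ha => ?_
  have hwa := hw a ha
  have h2 := Real.add_one_le_exp ((C + 1) * w a)
  have h3 := hu a ha
  have h4 := Real.exp_pos ((C + 1) * w a)
  nlinarith

lemma smoothFamily_of_bounded (hw : ∀ a ∈ A, 0 ≤ w a) {v : α → ℝ} (hvm : Measurable v) {C : ℝ}
    (hC : 0 ≤ C) (hv : ∀ a ∈ A, |v a| ≤ C) (k : ℕ) : SmoothFamily A w k (fun _ a => v a) := by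
  refine smoothFamily_of_le hvm hC fun a ha => (hv a ha).trans ?_
  have : 1 ≤ Real.exp (C * w a) := Real.one_le_exp (mul_nonneg hC (hw a ha))
  nlinarith

/-- The pattern of all tilts with a bounded input: the coefficient of `s` is at most linear in the
weight and that of `s²` is bounded, so the exponential stays of exponential growth. -/
lemma smoothFamily_exp_quadratic (hw : ∀ a ∈ A, 0 ≤ w a) {u v : α → ℝ} (hum : Measurable u)
    (hvm : Measurable v) {C : ℝ} (hC : 0 ≤ C) (hu : ∀ a ∈ A, |u a| ≤ C * w a)
    (hv : ∀ a ∈ A, |v a| ≤ C) (k : ℕ) :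
    SmoothFamily A w k (fun s a => Real.exp (s * u a + s ^ 2 * v a)) := by
  have h1 := smoothFamily_of_le_weight hw hum hC hu k
  have h2 := smoothFamily_of_bounded hw hvm hC hv k
  have h3 := (smoothFamily_id (k := k) hw)
  have h4 := (h3.mul hw h1).add hw ((h3.mul hw h3).mul hw h2)
  simp only [← sq] at h4
  refine h4.exp hw (expGrowth_of_le_exp hw hC fun R s hs a ha => ?_)
  rw [abs_of_pos (Real.exp_pos _)]
  exact Real.exp_le_exp.mpr ((le_abs_self _).trans (abs_quadratic_le hs (hu a ha) (hv a ha)))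

variable {B : Set β} {ρ : Measure β} [IsProbabilityMeasure ρ]

lemma smoothFamily_exp_quadratic_prod (hw : ∀ a ∈ A, 0 ≤ w a) {u v : α × β → ℝ}
    (hum : Measurable u) (hvm : Measurable v) {C : ℝ} (hC : 0 ≤ C)
    (hu : ∀ p ∈ A ×ˢ B, |u p| ≤ C * w p.1) (hv : ∀ p ∈ A ×ˢ B, |v p| ≤ C) (k : ℕ) :
    SmoothFamily (A ×ˢ B) (sumWeight w fun _ => 0) k
      (fun s p => Real.exp (s * u p + s ^ 2 * v p)) :=
  smoothFamily_exp_quadratic (fun p hp => by simpa [sumWeight] using hw p.1 hp.1) hum hvm hC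
    (fun p hp => by simpa [sumWeight] using hu p hp) hv k

/-- The integrand is at least `exp(-(R C w + R² C))`, and `ρ` is a probability, so the integral
obeys the same lower bound. This makes division by the output density harmless. -/
lemma expGrowth_inv_integral_exp_quadratic (hw : ∀ a ∈ A, 0 ≤ w a) {u v : α × β → ℝ}
    (hum : Measurable u) (hvm : Measurable v) {C : ℝ} (hC : 0 ≤ C)
    (hu : ∀ p ∈ A ×ˢ B, |u p| ≤ C * w p.1) (hv : ∀ p ∈ A ×ˢ B, |v p| ≤ C)
    (hB : ∀ᵐ b ∂ρ, b ∈ B) :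
    (∀ s, ∀ a ∈ A, 0 < ∫ b, Real.exp (s * u (a, b) + s ^ 2 * v (a, b)) ∂ρ) ∧
    ExpGrowth A w (fun s a => (∫ b, Real.exp (s * u (a, b) + s ^ 2 * v (a, b)) ∂ρ)⁻¹) := by
  have hlow : ∀ R s, |s| ≤ R → ∀ a ∈ A, Real.exp (-(R * C * w a + R ^ 2 * C)) ≤
      ∫ b, Real.exp (s * u (a, b) + s ^ 2 * v (a, b)) ∂ρ := by
    intro R s hs a ha
    have hint := (smoothFamily_exp_quadratic_prod (B := B) hw hum hvm hC hu hv 0).integrable_right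
      (ρ := ρ) hB (by simp) ha s
    calc Real.exp (-(R * C * w a + R ^ 2 * C))
        = ∫ _, Real.exp (-(R * C * w a + R ^ 2 * C)) ∂ρ := by simp
      _ ≤ _ := by
        refine integral_mono_ae (integrable_const _) hint ?_
        filter_upwards [hB] with b hb
        exact Real.exp_le_exp.mpr (abs_le.mp (abs_quadratic_le hs (hu (a, b) ⟨ha, hb⟩)
          (hv (a, b) ⟨ha, hb⟩))).1
  have hpos : ∀ s, ∀ a ∈ A, 0 < ∫ b, Real.exp (s * u (a, b) + s ^ 2 * v (a, b)) ∂ρ :=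
    fun s a ha => (Real.exp_pos _).trans_le (hlow |s| s le_rfl a ha)
  refine ⟨hpos, expGrowth_of_le_exp hw hC fun R s hs a ha => ?_⟩
  rw [abs_of_pos (inv_pos.mpr (hpos s a ha)), ← inv_inv (Real.exp _), ← Real.exp_neg]
  exact inv_anti₀ (Real.exp_pos _) (hlow R s hs a ha)

lemma hasDerivAt_exp_quadratic (u v s : ℝ) :
    HasDerivAt (fun s => Real.exp (s * u + s ^ 2 * v))
      ((u + 2 * s * v) * Real.exp (s * u + s ^ 2 * v)) s := by
  have h1 : HasDerivAt (fun s : ℝ => s * u + s ^ 2 * v) (1 * u + (2 * s ^ 1 * 1) * v) s :=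
    ((hasDerivAt_id s).mul_const u).add (((hasDerivAt_id s).pow 2).mul_const v)
  convert! h1.exp using 1
  ring

lemma smoothFamily_deriv_exp_quadratic (hw : ∀ a ∈ A, 0 ≤ w a) {u v : α → ℝ} (hum : Measurable u)
    (hvm : Measurable v) {C : ℝ} (hC : 0 ≤ C) (hu : ∀ a ∈ A, |u a| ≤ C * w a)
    (hv : ∀ a ∈ A, |v a| ≤ C) (k : ℕ) :
    SmoothFamily A w k (fun s a => (u a + 2 * s * v a) * Real.exp (s * u a + s ^ 2 * v a)) :=
  ((smoothFamily_of_le_weight hw hum hC hu k).add hw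
    (((smoothFamily_id hw).const_mul hw 2).mul hw (smoothFamily_of_bounded hw hvm hC hv k))).mul hw
      (smoothFamily_exp_quadratic hw hum hvm hC hu hv k)

lemma integral_exp_quadratic (hw : ∀ a ∈ A, 0 ≤ w a) {u v : α × β → ℝ}
    (hum : Measurable u) (hvm : Measurable v) {C : ℝ} (hC : 0 ≤ C)
    (hu : ∀ p ∈ A ×ˢ B, |u p| ≤ C * w p.1) (hv : ∀ p ∈ A ×ˢ B, |v p| ≤ C)
    (hB : ∀ᵐ b ∂ρ, b ∈ B) (k : ℕ) :
    SmoothFamily A w k (fun s a => ∫ b, Real.exp (s * u (a, b) + s ^ 2 * v (a, b)) ∂ρ) ∧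
    SmoothFamily A w k (fun s a => ∫ b, (u (a, b) + 2 * s * v (a, b)) *
      Real.exp (s * u (a, b) + s ^ 2 * v (a, b)) ∂ρ) ∧
    ∀ s, ∀ a ∈ A, Integrable (fun b => (u (a, b) + 2 * s * v (a, b)) *
        Real.exp (s * u (a, b) + s ^ 2 * v (a, b))) ρ ∧
      HasDerivAt (fun s => ∫ b, Real.exp (s * u (a, b) + s ^ 2 * v (a, b)) ∂ρ)
        (∫ b, (u (a, b) + 2 * s * v (a, b)) *
          Real.exp (s * u (a, b) + s ^ 2 * v (a, b)) ∂ρ) s := by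
  have h1 := smoothFamily_exp_quadratic_prod hw hum hvm hC hu hv
  have h2 : ∀ k, SmoothFamily (A ×ˢ B) (sumWeight w fun _ => 0) k
      (fun s p => (u p + 2 * s * v p) * Real.exp (s * u p + s ^ 2 * v p)) :=
    smoothFamily_deriv_exp_quadratic (fun p hp => by simpa [sumWeight] using hw p.1 hp.1) hum hvm hC
      (fun p hp => by simpa [sumWeight] using hu p hp) hv
  refine ⟨(h1 k).integral_right hw hB (by simp), (h2 k).integral_right hw hB (by simp),
    fun s a ha => ⟨(h2 0).integrable_right hB (by simp) ha s,
      (h1 0).hasDerivAt_integral (h2 0) (fun s p _ => hasDerivAt_exp_quadratic _ _ s) hB (by simp)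
        ha s⟩⟩

end Quadratic

/-- The law `ν` has smooth MMSE, finite mutual information, and satisfies the
I-MMSE relation. -/
structure IsRegularInput (ν : Measure ℂ) : Prop where
  memLp : MemLp (fun x : ℂ => x) 2 ν
  contDiffOn : ContDiffOn ℝ (⊤ : ℕ∞) (fun t : ℝ => mmseFun ν ((√t : ℝ) : ℂ)) (Set.Ici 0)
  integrable_log : ∀ s : ℝ, Integrable (fun p => Real.log (outputDensity ν s (s * p.1 + p.2)))
    (ν.prod stdGaussian)
  hasDerivWithinAt : ∀ t : ℝ, 0 ≤ t → HasDerivWithinAt (fun t : ℝ => infoFun ν ((√t : ℝ) : ℂ))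
    (mmseFun ν ((√t : ℝ) : ℂ)) (Set.Ici 0) t

/-! ### Smoothness of the MMSE in the gain, for bounded inputs -/

section Bounded

set_option linter.unusedSectionVars false

variable {ν : Measure ℂ} [IsProbabilityMeasure ν] {M : ℝ}

lemma tilt_ofReal_mul (s : ℝ) (y x : ℂ) :
    tilt y (s * x) = s * (2 * (y * conj x).re) + s ^ 2 * (-‖x‖ ^ 2) := by
  rw [tilt, norm_mul, Complex.norm_real, mul_pow, Real.norm_eq_abs, sq_abs, map_mul,
    Complex.conj_ofReal, mul_left_comm, Complex.re_ofReal_mul]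
  ring

lemma tilt_ofReal_mul_add (s : ℝ) (x z x' : ℂ) :
    tilt (s * x + z) (s * x') =
      s * (2 * (z * conj x').re) + s ^ 2 * (2 * (x * conj x').re - ‖x'‖ ^ 2) := by
  rw [tilt_ofReal_mul, add_mul, Complex.add_re, mul_assoc, Complex.re_ofReal_mul]
  ring

lemma abs_two_mul_re_le (y : ℂ) {x : ℂ} (hx : ‖x‖ ≤ M) : |2 * (y * conj x).re| ≤ 2 * M * ‖y‖ := by
  have h : |(y * conj x).re| ≤ ‖y‖ * ‖x‖ := by
    simpa using Complex.abs_re_le_norm (y * conj x)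
  rw [abs_mul, abs_two]
  nlinarith [mul_le_mul_of_nonneg_left hx (norm_nonneg y)]

lemma measurable_two_mul_re {α : Type*} [MeasurableSpace α] {f g : α → ℂ} (hf : Measurable f)
    (hg : Measurable g) : Measurable (fun a => 2 * (f a * conj (g a)).re) :=
  (Complex.continuous_re.measurable.comp
    (hf.mul (Complex.continuous_conj.measurable.comp hg))).const_mul 2

/-- The constant is larger than needed here so that it also serves the shifted tilt: `2M` bounds the
linear coefficient, and `3M² = 2M² + M²` the quadratic one at `y = s x + z`. -/
lemma tilt_coeff_bounds (hM : 0 ≤ M) : ∀ p ∈ (Set.univ : Set ℂ) ×ˢ Metric.closedBall (0 : ℂ) M,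
    |2 * (p.1 * conj p.2).re| ≤ (2 * M + 3 * M ^ 2) * ‖p.1‖ ∧
      |-‖p.2‖ ^ 2| ≤ 2 * M + 3 * M ^ 2 := by
  rintro ⟨y, x⟩ ⟨-, hx⟩
  have hx' : ‖x‖ ≤ M := mem_closedBall_zero_iff.mp hx
  refine ⟨(abs_two_mul_re_le y hx').trans ?_, ?_⟩
  · gcongr
    nlinarith
  · simp only [abs_neg, abs_pow, abs_norm]
    have := pow_le_pow_left₀ (norm_nonneg x) hx' 2
    nlinarith

lemma smoothFamily_exp_tilt (hM : 0 ≤ M) (k : ℕ) :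
    SmoothFamily ((Set.univ : Set ℂ) ×ˢ Metric.closedBall (0 : ℂ) M)
      (sumWeight (fun y : ℂ => ‖y‖) fun _ => 0) k
      (fun s p => Real.exp (tilt p.1 (s * p.2))) := by
  simp_rw [tilt_ofReal_mul]
  exact smoothFamily_exp_quadratic_prod (C := 2 * M + 3 * M ^ 2) (fun _ _ => norm_nonneg _)
    (measurable_two_mul_re measurable_fst measurable_snd) (by fun_prop) (by positivity)
    (fun p hp => (tilt_coeff_bounds hM p hp).1) (fun p hp => (tilt_coeff_bounds hM p hp).2) k

lemma smoothFamily_outputDensity (hM : 0 ≤ M) (hν : ∀ᵐ x ∂ν, x ∈ Metric.closedBall (0 : ℂ) M)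
    (k : ℕ) : SmoothFamily (Set.univ : Set ℂ) (fun y : ℂ => ‖y‖) k
      (fun s y => outputDensity ν s y) :=
  (smoothFamily_exp_tilt hM k).integral_right (fun _ _ => norm_nonneg _) hν (by simp)

lemma expGrowth_inv_outputDensity (hM : 0 ≤ M)
    (hν : ∀ᵐ x ∂ν, x ∈ Metric.closedBall (0 : ℂ) M) :
    ExpGrowth (Set.univ : Set ℂ) (fun y : ℂ => ‖y‖) (fun s y => (outputDensity ν s y)⁻¹) := by
  simp_rw [outputDensity, tilt_ofReal_mul]
  exact (expGrowth_inv_integral_exp_quadratic (C := 2 * M + 3 * M ^ 2)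
    (u := fun p : ℂ × ℂ => 2 * (p.1 * conj p.2).re) (v := fun p : ℂ × ℂ => -‖p.2‖ ^ 2)
    (fun _ _ => norm_nonneg _)
    (measurable_two_mul_re measurable_fst measurable_snd) (by fun_prop) (by positivity)
    (fun p hp => (tilt_coeff_bounds hM p hp).1) (fun p hp => (tilt_coeff_bounds hM p hp).2) hν).2

lemma integrable_exp_tilt_smul (hν : ∀ᵐ x ∂ν, x ∈ Metric.closedBall (0 : ℂ) M) (g y : ℂ) :
    Integrable (fun x => Real.exp (tilt y (g * x)) • x) ν := by
  refine (((integrable_exp_tilt (ν := ν) (g := g) y).mul_const M)).mono'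
    (by fun_prop : Measurable _).aestronglyMeasurable ?_
  filter_upwards [hν] with x hx
  rw [norm_smul, Real.norm_of_nonneg (Real.exp_pos _).le]
  gcongr
  exact mem_closedBall_zero_iff.mp hx

lemma smoothFamily_inputMoment (hM : 0 ≤ M) (hν : ∀ᵐ x ∂ν, x ∈ Metric.closedBall (0 : ℂ) M)
    {L : ℂ →L[ℝ] ℝ} (hL : ∀ z, |L z| ≤ ‖z‖) (k : ℕ) :
    SmoothFamily (Set.univ : Set ℂ) (fun y : ℂ => ‖y‖) k (fun s y => L (inputMoment ν s y)) := by
  have hw : ∀ p ∈ (Set.univ : Set ℂ) ×ˢ Metric.closedBall (0 : ℂ) M,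
      0 ≤ sumWeight (fun y : ℂ => ‖y‖) (fun _ : ℂ => 0) p := fun p _ => by
    simp [sumWeight]
  have h1 : SmoothFamily ((Set.univ : Set ℂ) ×ˢ Metric.closedBall (0 : ℂ) M)
      (sumWeight (fun y : ℂ => ‖y‖) fun _ => 0) k (fun _ p => L p.2) := by
    refine smoothFamily_of_le (by fun_prop) hM ?_
    rintro p hp
    have h2 : 1 ≤ Real.exp (M * sumWeight (fun y : ℂ => ‖y‖) (fun _ : ℂ => 0) p) :=
      Real.one_le_exp (mul_nonneg hM (hw p hp))
    have h3 : ‖p.2‖ ≤ M := mem_closedBall_zero_iff.mp hp.2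
    nlinarith [hL p.2]
  have h2 := ((smoothFamily_exp_tilt hM k).mul hw h1).integral_right (ρ := ν)
    (fun _ _ => norm_nonneg _) hν (by simp)
  have h3 : ∀ (s : ℝ) (y : ℂ), L (inputMoment ν s y) =
      ∫ x, Real.exp (tilt y (s * x)) * L x ∂ν := by
    intro s y
    have hint := integrable_exp_tilt_smul hν (s : ℂ) y
    rw [inputMoment, ← L.integral_comp_comm hint]
    simp only [map_smul, smul_eq_mul]
  simpa only [h3] using h2

lemma smoothFamily_norm_inputMoment_sq_div (hM : 0 ≤ M)
    (hν : ∀ᵐ x ∂ν, x ∈ Metric.closedBall (0 : ℂ) M) (k : ℕ) :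
    SmoothFamily (Set.univ : Set ℂ) (fun y : ℂ => ‖y‖) k
      (fun s y => ‖inputMoment ν s y‖ ^ 2 / outputDensity ν s y) := by
  have hw : ∀ y ∈ (Set.univ : Set ℂ), 0 ≤ ‖y‖ := fun _ _ => norm_nonneg _
  have hre := smoothFamily_inputMoment hM hν (L := Complex.reCLM)
    (fun z => Complex.abs_re_le_norm z) k
  have him := smoothFamily_inputMoment hM hν (L := Complex.imCLM)
    (fun z => Complex.abs_im_le_norm z) k
  have hinv := (smoothFamily_outputDensity hM hν k).inv hw
    (fun s y _ => (outputDensity_pos y).ne') (expGrowth_inv_outputDensity hM hν)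
  have := ((hre.mul hw hre).add hw (him.mul hw him)).mul hw hinv
  simp only [Complex.reCLM_apply, Complex.imCLM_apply] at this
  simpa only [← Complex.normSq_eq_norm_sq, Complex.normSq_apply, div_eq_mul_inv] using this

/-- Families on `ℂ` as families on `Unit × ℂ`, for integration against the noise. -/
lemma SmoothFamily.unit_prod {β : Type*} [MeasurableSpace β] {B : Set β} {w : β → ℝ} {k : ℕ}
    {g : ℝ → β → ℝ} (hg : SmoothFamily B w k g) :
    SmoothFamily ((Set.univ : Set Unit) ×ˢ B) (sumWeight (fun _ => 0) w) k
      (fun s p => g s p.2) :=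
  hg.comp measurable_snd (fun _ h => h.2) (fun p _ => by simp [sumWeight])

lemma contDiff_mmseFun (hM : 0 ≤ M) (hν : ∀ᵐ x ∂ν, x ∈ Metric.closedBall (0 : ℂ) M) :
    ContDiff ℝ (⊤ : ℕ∞) (fun s : ℝ => mmseFun ν s) := by
  refine contDiff_const.sub ?_
  exact SmoothFamily.contDiff (Set.mem_univ ()) fun k =>
    (smoothFamily_norm_inputMoment_sq_div hM hν k).unit_prod.integral_right (ρ := stdGaussian)
      (fun _ _ => le_rfl) (by simp) integrable_exp_mul_norm_stdGaussian

/-! ### The I-MMSE relation for bounded inputs -/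

lemma integral_outputDensity (g : ℂ) : ∫ y, outputDensity ν g y ∂stdGaussian = 1 := by
  have := integral_comp_snd_jointLaw (ν := ν) (g := g) (f := fun _ => (1 : ℝ)) (by fun_prop)
  simpa using this.symm

/-- The derivative of `outputDensity ν s y` in `s`. -/
noncomputable def outputDensityDeriv (ν : Measure ℂ) (s : ℝ) (y : ℂ) : ℝ :=
  ∫ x, (2 * (y * conj x).re + 2 * s * (-‖x‖ ^ 2)) * Real.exp (tilt y (s * x)) ∂ν

lemma smoothFamily_outputDensityDeriv (hM : 0 ≤ M)
    (hν : ∀ᵐ x ∂ν, x ∈ Metric.closedBall (0 : ℂ) M) :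
    SmoothFamily (Set.univ : Set ℂ) (fun y : ℂ => ‖y‖) 0 (outputDensityDeriv ν) ∧
    ∀ (s : ℝ) (y : ℂ), Integrable (fun x => (2 * (y * conj x).re + 2 * s * (-‖x‖ ^ 2)) *
        Real.exp (tilt y (s * x))) ν ∧
      HasDerivAt (fun s : ℝ => outputDensity ν s y) (outputDensityDeriv ν s y) s := by
  have h := integral_exp_quadratic (C := 2 * M + 3 * M ^ 2) (ρ := ν) (w := fun y : ℂ => ‖y‖)
    (u := fun p : ℂ × ℂ => 2 * (p.1 * conj p.2).re) (v := fun p : ℂ × ℂ => -‖p.2‖ ^ 2)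
    (fun _ _ => norm_nonneg _)
    (measurable_two_mul_re measurable_fst measurable_snd) (by fun_prop) (by positivity)
    (fun p hp => (tilt_coeff_bounds hM p hp).1) (fun p hp => (tilt_coeff_bounds hM p hp).2) hν 0
  simp only [← tilt_ofReal_mul] at h
  exact ⟨h.2.1, fun s y => h.2.2 s y (Set.mem_univ y)⟩

/-- Differentiate the constant total mass of the output density under the integral. -/
lemma integral_outputDensityDeriv (hM : 0 ≤ M) (hν : ∀ᵐ x ∂ν, x ∈ Metric.closedBall (0 : ℂ) M)
    (s : ℝ) : Integrable (outputDensityDeriv ν s) stdGaussian ∧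
      ∫ y, outputDensityDeriv ν s y ∂stdGaussian = 0 := by
  obtain ⟨h1, h2⟩ := smoothFamily_outputDensityDeriv hM hν
  refine ⟨h1.unit_prod.integrable_right (by simp) integrable_exp_mul_norm_stdGaussian
    (Set.mem_univ ()) s, ?_⟩
  have h3 := (smoothFamily_outputDensity hM hν 0).unit_prod.hasDerivAt_integral (ρ := stdGaussian)
    h1.unit_prod (fun s p _ => (h2 s p.2).2) (by simp) integrable_exp_mul_norm_stdGaussian
    (Set.mem_univ ()) s
  simp only [integral_outputDensity] at h3
  exact h3.unique (hasDerivAt_const s 1)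

/-- The derivative of `outputDensity ν s (s x + z)` in `s`. -/
noncomputable def shiftedDensityDeriv (ν : Measure ℂ) (s : ℝ) (p : ℂ × ℂ) : ℝ :=
  ∫ x, (2 * (p.2 * conj x).re + 2 * s * (2 * (p.1 * conj x).re - ‖x‖ ^ 2)) *
    Real.exp (tilt (s * p.1 + p.2) (s * x)) ∂ν

lemma smoothFamily_shiftedDensity (hM : 0 ≤ M) (hν : ∀ᵐ x ∂ν, x ∈ Metric.closedBall (0 : ℂ) M) :
    SmoothFamily (Metric.closedBall (0 : ℂ) M ×ˢ (Set.univ : Set ℂ)) (fun p => ‖p.2‖) 0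
      (fun s p => outputDensity ν s (s * p.1 + p.2)) ∧
    SmoothFamily (Metric.closedBall (0 : ℂ) M ×ˢ (Set.univ : Set ℂ)) (fun p => ‖p.2‖) 0
      (shiftedDensityDeriv ν) ∧
    ExpGrowth (Metric.closedBall (0 : ℂ) M ×ˢ (Set.univ : Set ℂ)) (fun p => ‖p.2‖)
      (fun s p => (outputDensity ν s (s * p.1 + p.2))⁻¹) ∧
    ∀ s, ∀ p ∈ Metric.closedBall (0 : ℂ) M ×ˢ (Set.univ : Set ℂ),
      HasDerivAt (fun s : ℝ => outputDensity ν s (s * p.1 + p.2)) (shiftedDensityDeriv ν s p) s := by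
  have hb : ∀ q ∈ (Metric.closedBall (0 : ℂ) M ×ˢ (Set.univ : Set ℂ)) ×ˢ Metric.closedBall (0 : ℂ) M,
      |2 * (q.1.2 * conj q.2).re| ≤ (2 * M + 3 * M ^ 2) * ‖q.1.2‖ ∧
      |2 * (q.1.1 * conj q.2).re - ‖q.2‖ ^ 2| ≤ 2 * M + 3 * M ^ 2 := by
    rintro ⟨⟨x, z⟩, x'⟩ ⟨⟨hx, -⟩, hx'⟩
    have h1 : ‖x‖ ≤ M := mem_closedBall_zero_iff.mp hx
    have h2 : ‖x'‖ ≤ M := mem_closedBall_zero_iff.mp hx'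
    refine ⟨(tilt_coeff_bounds hM (z, x') ⟨Set.mem_univ _, hx'⟩).1, ?_⟩
    refine (abs_sub _ _).trans ?_
    have h3 := abs_two_mul_re_le x h2
    have h4 := pow_le_pow_left₀ (norm_nonneg x') h2 2
    simp only [abs_pow, abs_norm]
    nlinarith [mul_le_mul_of_nonneg_left h1 hM]
  have hum : Measurable fun q : (ℂ × ℂ) × ℂ => 2 * (q.1.2 * conj q.2).re :=
    measurable_two_mul_re (by fun_prop) (by fun_prop)
  have hvm : Measurable fun q : (ℂ × ℂ) × ℂ => 2 * (q.1.1 * conj q.2).re - ‖q.2‖ ^ 2 :=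
    (measurable_two_mul_re (by fun_prop) (by fun_prop)).sub (by fun_prop)
  have h1 := integral_exp_quadratic (C := 2 * M + 3 * M ^ 2) (ρ := ν)
    (w := fun p : ℂ × ℂ => ‖p.2‖) (fun _ _ => norm_nonneg _) hum hvm (by positivity)
    (fun p hp => (hb p hp).1) (fun p hp => (hb p hp).2) hν 0
  have h2 := expGrowth_inv_integral_exp_quadratic (C := 2 * M + 3 * M ^ 2) (ρ := ν)
    (w := fun p : ℂ × ℂ => ‖p.2‖) (fun _ _ => norm_nonneg _) hum hvm (by positivity)
    (fun p hp => (hb p hp).1) (fun p hp => (hb p hp).2) hν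
  simp only [← tilt_ofReal_mul_add] at h1 h2
  exact ⟨h1.1, h1.2.1, h2.2, fun s p hp => (h1.2.2 s p hp).2⟩

/-- The chain rule: the first term is the explicit dependence on `s`, the second comes from the
argument `s x + z` moving with velocity `x`, since the gradient of the output density in `y` is `2s`
times the input moment. -/
lemma shiftedDensityDeriv_eq (hM : 0 ≤ M) (hν : ∀ᵐ x ∂ν, x ∈ Metric.closedBall (0 : ℂ) M)
    (s : ℝ) (p : ℂ × ℂ) : shiftedDensityDeriv ν s p =
      outputDensityDeriv ν s (s * p.1 + p.2) +
        2 * s * (p.1 * conj (inputMoment ν s (s * p.1 + p.2))).re := by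
  obtain ⟨x, z⟩ := p
  -- The map `w ↦ Re(x conj w)` as a real-linear functional, so that it commutes with the integral
  -- defining `inputMoment`.
  set L : ℂ →L[ℝ] ℝ := x.re • Complex.reCLM + x.im • Complex.imCLM with hL
  have hLe : ∀ w, L w = (x * conj w).re := by
    intro w; simp [hL]
  have hint := integrable_exp_tilt_smul hν (s : ℂ) (s * x + z)
  have h1 := ((smoothFamily_outputDensityDeriv hM hν).2 s (s * x + z)).1
  have h2 := (L.integrable_comp hint).const_mul (2 * s)
  rw [← hLe, inputMoment, ← L.integral_comp_comm hint, ← integral_const_mul, outputDensityDeriv,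
    ← integral_add h1 h2, shiftedDensityDeriv]
  refine integral_congr_ae (ae_of_all _ fun x' => ?_)
  simp only [map_smul, smul_eq_mul]
  simp only [hLe]
  rw [add_mul (s * x : ℂ), Complex.add_re, mul_assoc (s : ℂ), Complex.re_ofReal_mul]
  ring

lemma norm_posteriorMean_le (hν : ∀ᵐ x ∂ν, x ∈ Metric.closedBall (0 : ℂ) M)
    (g y : ℂ) : ‖posteriorMean ν g y‖ ≤ M := by
  have hpos := outputDensity_pos (ν := ν) (g := g) y
  have h1 : ‖inputMoment ν g y‖ ≤ outputDensity ν g y * M := by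
    rw [inputMoment, outputDensity, ← integral_mul_const]
    refine norm_integral_le_of_norm_le ((integrable_exp_tilt y).mul_const M) ?_
    filter_upwards [hν] with x hx
    rw [norm_smul, Real.norm_of_nonneg (Real.exp_pos _).le]
    gcongr
    exact mem_closedBall_zero_iff.mp hx
  rw [posteriorMean, norm_smul, Real.norm_of_nonneg (inv_nonneg.mpr hpos.le), inv_mul_le_iff₀ hpos]
  exact h1

lemma ae_mem_prod (hν : ∀ᵐ x ∂ν, x ∈ Metric.closedBall (0 : ℂ) M) :
    ∀ᵐ p ∂(ν.prod stdGaussian), p ∈ Metric.closedBall (0 : ℂ) M ×ˢ (Set.univ : Set ℂ) := by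
  have := Measure.quasiMeasurePreserving_fst (μ := ν) (ν := stdGaussian) |>.ae hν
  filter_upwards [this] with p hp
  exact ⟨hp, Set.mem_univ _⟩

/-- The core of I-MMSE. Under the joint law the explicit term is a score function with mean zero,
and the other is `2s E Re(x conj x̂) = 2s E|x̂|²`, with `x̂` the posterior mean. -/
lemma integral_shiftedDensityDeriv_div (hM : 0 ≤ M)
    (hν : ∀ᵐ x ∂ν, x ∈ Metric.closedBall (0 : ℂ) M) (s : ℝ) :
    ∫ p, shiftedDensityDeriv ν s p * (outputDensity ν s (s * p.1 + p.2))⁻¹ ∂(ν.prod stdGaussian) =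
      2 * s * ∫ y, ‖inputMoment ν s y‖ ^ 2 / outputDensity ν s y ∂stdGaussian := by
  obtain ⟨hT, hT0⟩ := integral_outputDensityDeriv hM hν s
  have hTm : Measurable (outputDensityDeriv ν s) :=
    (smoothFamily_outputDensityDeriv hM hν).1.measurable s
  have hconjm : Measurable (fun z : ℂ => conj z) := Complex.continuous_conj.measurable
  have hm1 : Measurable fun p : ℂ × ℂ => p.1 * conj (posteriorMean ν s p.2) := by fun_prop
  have hm2 : Measurable fun p : ℂ × ℂ => (p.1 * conj (posteriorMean ν s p.2)).re :=
    Complex.continuous_re.measurable.comp hm1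
  have hm3 : Measurable fun y => outputDensityDeriv ν s y * (outputDensity ν s y)⁻¹ := by fun_prop
  have e1 : ∀ y, outputDensity ν s y • (outputDensityDeriv ν s y * (outputDensity ν s y)⁻¹) =
      outputDensityDeriv ν s y := by
    intro y
    have := (outputDensity_pos (ν := ν) (g := s) y).ne'
    simp only [smul_eq_mul]; field_simp
  have i1 : Integrable (fun p : ℂ × ℂ =>
      outputDensityDeriv ν s p.2 * (outputDensity ν s p.2)⁻¹) (jointLaw ν s) := by
    rw [integrable_comp_snd_jointLaw
      (f := fun y => outputDensityDeriv ν s y * (outputDensity ν s y)⁻¹) hm3.aestronglyMeasurable]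
    simpa only [e1] using hT
  have v1 : ∫ p : ℂ × ℂ, outputDensityDeriv ν s p.2 * (outputDensity ν s p.2)⁻¹ ∂jointLaw ν s = 0 := by
    rw [integral_comp_snd_jointLaw
      (f := fun y => outputDensityDeriv ν s y * (outputDensity ν s y)⁻¹) hm3.aestronglyMeasurable]
    simpa only [e1] using hT0
  have i2 : Integrable (fun p : ℂ × ℂ => p.1 * conj (posteriorMean ν s p.2)) (jointLaw ν s) := by
    refine Integrable.of_bound hm1.aestronglyMeasurable (M * M) ?_
    have h3 : jointLaw ν s ≪ ν.prod stdGaussian := withDensity_absolutelyContinuous _ _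
    filter_upwards [h3.ae_le (ae_mem_prod hν)] with p hp
    rw [norm_mul, RCLike.norm_conj]
    exact mul_le_mul (mem_closedBall_zero_iff.mp hp.1) (norm_posteriorMean_le hν _ _)
      (norm_nonneg _) hM
  have i3 : Integrable (fun p : ℂ × ℂ => 2 * s * (p.1 * conj (posteriorMean ν s p.2)).re)
      (jointLaw ν s) := i2.re.const_mul (2 * s)
  calc _ = ∫ p, (outputDensityDeriv ν s p.2 * (outputDensity ν s p.2)⁻¹ +
        2 * s * (p.1 * conj (posteriorMean ν s p.2)).re) ∂jointLaw ν s := by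
        rw [jointLaw_eq_map, integral_map (by fun_prop) (by fun_prop : Measurable _).aestronglyMeasurable]
        refine integral_congr_ae (ae_of_all _ fun p => ?_)
        simp only [shiftedDensityDeriv_eq hM hν]
        rw [posteriorMean, Complex.real_smul, map_mul, Complex.conj_ofReal, mul_left_comm,
          Complex.re_ofReal_mul]
        ring
    _ = _ := by
        rw [integral_add i1 i3, v1, zero_add, integral_const_mul,
          integral_re_input_mul_posteriorMean i2]

lemma hasDerivAt_infoFun (hM : 0 ≤ M) (hν : ∀ᵐ x ∂ν, x ∈ Metric.closedBall (0 : ℂ) M) :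
    (∀ s : ℝ, Integrable (fun p => Real.log (outputDensity ν s (s * p.1 + p.2)))
      (ν.prod stdGaussian)) ∧
    ∀ s : ℝ, HasDerivAt (fun s : ℝ => infoFun ν s) (2 * s * mmseFun ν s) s := by
  obtain ⟨h1, h2, h3, h4⟩ := smoothFamily_shiftedDensity hM hν
  have hw : ∀ p ∈ Metric.closedBall (0 : ℂ) M ×ˢ (Set.univ : Set ℂ), 0 ≤ ‖p.2‖ :=
    fun _ _ => norm_nonneg _
  have h5 := h1.log hw (fun s p _ => outputDensity_pos _) h3
  have h6 := h2.mul hw (h1.inv hw (fun s p _ => (outputDensity_pos _).ne') h3)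
  have hexp : ∀ C : ℝ, Integrable (fun p : ℂ × ℂ => Real.exp (C * ‖p.2‖)) (ν.prod stdGaussian) :=
    fun C => (integrable_exp_mul_norm_stdGaussian C).comp_snd ν
  refine ⟨fun s => h5.unit_prod.integrable_right (ae_mem_prod hν) hexp (Set.mem_univ ()) s,
    fun s => ?_⟩
  have h7 := h5.unit_prod.hasDerivAt_integral (ρ := ν.prod stdGaussian) h6.unit_prod
    (fun s p hp => by
      simpa [div_eq_mul_inv] using (h4 s p.2 hp.2).log (outputDensity_pos _).ne')
    (ae_mem_prod hν) hexp (Set.mem_univ ()) s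
  simp only [integral_shiftedDensityDeriv_div hM hν] at h7
  have h8 := (((hasDerivAt_id s).pow 2).mul_const (∫ x, ‖x‖ ^ 2 ∂ν)).sub h7
  simp only [infoFun, Complex.norm_real, Real.norm_eq_abs, sq_abs]
  convert! h8 using 1
  simp [mmseFun]
  ring

lemma isRegularInput_of_bounded (hν : ∀ᵐ x ∂ν, ‖x‖ ≤ M) : IsRegularInput ν := by
  have hM : 0 ≤ M := by
    obtain ⟨x, hx⟩ := hν.exists
    exact (norm_nonneg x).trans hx
  have hν' : ∀ᵐ x ∂ν, x ∈ Metric.closedBall (0 : ℂ) M := by simpa using hν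
  have hc := contDiff_mmseFun hM hν'
  obtain ⟨h1, h2⟩ := hasDerivAt_infoFun hM hν'
  refine ⟨MemLp.of_bound (by fun_prop) M hν, ?_, h1, fun t ht => ?_⟩
  -- Evenness in `s` is the rotation invariance for `u = -1`.
  · refine contDiffOn_comp_sqrt_of_even hc fun s => ?_
    have := mmseFun_rotate (ν := ν) (g := (s : ℂ)) (u := -1) (by simp)
    simpa using this
  · exact hasDerivWithinAt_comp_sqrt (fun s => (h2 s).differentiableAt) hc.continuous
      (fun s => (h2 s).deriv) ht

end Bounded

/-! ### Gaussian input -/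

/-- Completing the square: a tilted standard Gaussian law is a Gaussian law. -/
lemma integral_exp_tilt_stdGaussian {E : Type*} [NormedAddCommGroup E] [NormedSpace ℝ E]
    (s : ℝ) (y : ℂ) (f : ℂ → E) :
    ∫ x, Real.exp (tilt y (s * x)) • f x ∂stdGaussian =
      ((1 + s ^ 2)⁻¹ * Real.exp (s ^ 2 / (1 + s ^ 2) * ‖y‖ ^ 2)) •
        ∫ u, f ((√(1 + s ^ 2))⁻¹ • (u + (s / √(1 + s ^ 2)) • y)) ∂stdGaussian := by
  have ha : 0 < 1 + s ^ 2 := by positivity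
  set b := √(1 + s ^ 2) with hb
  have hb0 : 0 < b := Real.sqrt_pos.mpr ha
  have hb2 : b ^ 2 = 1 + s ^ 2 := Real.sq_sqrt ha.le
  set c := Real.exp (s ^ 2 / (1 + s ^ 2) * ‖y‖ ^ 2) with hc
  -- With `u = b x - (s/b) y` and `b² = 1 + s²`, the exponent `-|x|² + tilt y (s x)` becomes `-|u|²
  -- + (s²/b²)|y|²`; the substitution has Jacobian `b⁻²`, as `ℂ` has real dimension two.
  set h : ℂ → E := fun u => (stdGaussianDensity u * c) • f (b⁻¹ • (u + (s / b) • y)) with hh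
  have hkey : ∀ x : ℂ, stdGaussianDensity x • Real.exp (tilt y (s * x)) • f x =
      h (b • x - (s / b) • y) := by
    intro x
    simp only [hh, sub_add_cancel, smul_smul, inv_mul_cancel₀ hb0.ne', one_smul]
    congr 1
    rw [stdGaussianDensity, stdGaussianDensity, hc, div_mul_eq_mul_div, div_mul_eq_mul_div,
      ← Real.exp_add, ← Real.exp_add, tilt_ofReal_mul]
    congr 2
    rw [← Complex.normSq_eq_norm_sq (b • x - _), Complex.normSq_sub, Complex.normSq_eq_norm_sq,
      Complex.normSq_eq_norm_sq, norm_smul, norm_smul, mul_pow, mul_pow, Real.norm_eq_abs,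
      Real.norm_eq_abs, sq_abs, sq_abs, hb2, div_pow, hb2]
    have h1 : (b • x * conj ((s / b) • y)).re = s * (y * conj x).re := by
      have h2 : b * (s / b) = s := by field_simp
      rw [Complex.real_smul, Complex.real_smul, map_mul, Complex.conj_ofReal, mul_mul_mul_comm,
        ← Complex.ofReal_mul, Complex.re_ofReal_mul, h2]
      simp only [Complex.mul_re, Complex.conj_re, Complex.conj_im]
      ring
    rw [h1]
    field_simp
    ring
  rw [integral_stdGaussian]
  simp_rw [hkey]
  rw [Measure.integral_comp_smul volume (fun v => h (v - (s / b) • y)) b,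
    integral_sub_right_eq_self h, Complex.finrank_real_complex, hb2, abs_of_pos (inv_pos.mpr ha),
    integral_stdGaussian, mul_smul]
  congr 1
  rw [← integral_smul]
  refine integral_congr_ae (ae_of_all _ fun u => ?_)
  simp only [hh]
  rw [mul_smul, smul_comm]

lemma integrable_id_stdGaussian : Integrable (fun z : ℂ => z) stdGaussian := by
  simpa using integrable_pow_mul_conj_pow_stdGaussian 1 0

lemma integral_id_stdGaussian : ∫ z : ℂ, z ∂stdGaussian = 0 := by
  simpa using integral_pow_mul_conj_pow_stdGaussian 1 0

lemma integral_norm_sq_stdGaussian : ∫ z : ℂ, ‖z‖ ^ 2 ∂stdGaussian = 1 := by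
  simpa using integral_norm_pow_stdGaussian 1

lemma outputDensity_stdGaussian (s : ℝ) (y : ℂ) :
    outputDensity stdGaussian s y =
      (1 + s ^ 2)⁻¹ * Real.exp (s ^ 2 / (1 + s ^ 2) * ‖y‖ ^ 2) := by
  rw [outputDensity]
  simpa using integral_exp_tilt_stdGaussian s y (fun _ => (1 : ℝ))

/-- The tilted law is a Gaussian centred at `s y / (1 + s²)`: the optimal estimator is linear. -/
lemma inputMoment_stdGaussian (s : ℝ) (y : ℂ) :
    inputMoment stdGaussian s y = (outputDensity stdGaussian s y * (s / (1 + s ^ 2))) • y := by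
  have ha : 0 < 1 + s ^ 2 := by positivity
  have hb2 : (√(1 + s ^ 2))⁻¹ * (s / √(1 + s ^ 2)) = s / (1 + s ^ 2) := by
    rw [inv_mul_eq_div, div_div, Real.mul_self_sqrt ha.le]
  rw [inputMoment, integral_exp_tilt_stdGaussian s y (fun x => x), ← outputDensity_stdGaussian,
    integral_smul, integral_add integrable_id_stdGaussian (integrable_const _),
    integral_id_stdGaussian, zero_add, integral_const, probReal_univ, one_smul, smul_smul, smul_smul,
    mul_assoc, hb2]

lemma integral_norm_add_sq_stdGaussian (s : ℝ) :
    Integrable (fun p : ℂ × ℂ => ‖s * p.1 + p.2‖ ^ 2) (stdGaussian.prod stdGaussian) ∧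
      ∫ p : ℂ × ℂ, ‖s * p.1 + p.2‖ ^ 2 ∂(stdGaussian.prod stdGaussian) = 1 + s ^ 2 := by
  have i0 := integrable_norm_pow_stdGaussian 2
  have i1 : Integrable (fun p : ℂ × ℂ => s ^ 2 * ‖p.1‖ ^ 2) (stdGaussian.prod stdGaussian) :=
    (i0.const_mul (s ^ 2)).comp_fst stdGaussian
  have i2 : Integrable (fun p : ℂ × ℂ => ‖p.2‖ ^ 2) (stdGaussian.prod stdGaussian) :=
    i0.comp_snd stdGaussian
  have hc : Integrable (fun z : ℂ => conj z) stdGaussian := by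
    simpa using integrable_pow_mul_conj_pow_stdGaussian 0 1
  have i3 : Integrable (fun p : ℂ × ℂ => p.1 * conj p.2) (stdGaussian.prod stdGaussian) :=
    integrable_id_stdGaussian.mul_prod hc
  have i4 : Integrable (fun p : ℂ × ℂ => 2 * s * (p.1 * conj p.2).re)
      (stdGaussian.prod stdGaussian) := i3.re.const_mul (2 * s)
  have e : ∀ p : ℂ × ℂ, ‖s * p.1 + p.2‖ ^ 2 =
      s ^ 2 * ‖p.1‖ ^ 2 + ‖p.2‖ ^ 2 + 2 * s * (p.1 * conj p.2).re := by
    intro p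
    rw [← Complex.normSq_eq_norm_sq, Complex.normSq_add, Complex.normSq_eq_norm_sq,
      Complex.normSq_eq_norm_sq, norm_mul, Complex.norm_real, mul_pow, Real.norm_eq_abs, sq_abs,
      mul_assoc (s : ℂ), Complex.re_ofReal_mul]
    ring
  have v3 : ∫ p : ℂ × ℂ, (p.1 * conj p.2).re ∂(stdGaussian.prod stdGaussian) = 0 := by
    have h1 := integral_re i3
    rw [integral_prod_mul (fun z : ℂ => z) (fun z : ℂ => conj z), integral_id_stdGaussian,
      zero_mul] at h1
    simpa using h1
  have i12 : Integrable (fun p : ℂ × ℂ => s ^ 2 * ‖p.1‖ ^ 2 + ‖p.2‖ ^ 2)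
      (stdGaussian.prod stdGaussian) := i1.add i2
  simp_rw [e]
  refine ⟨i12.add i4, ?_⟩
  have v1 : ∫ p : ℂ × ℂ, ‖p.1‖ ^ 2 ∂(stdGaussian.prod stdGaussian) = 1 := by
    have := integral_fun_fst (μ := stdGaussian) (ν := stdGaussian) (fun z : ℂ => ‖z‖ ^ 2)
    simpa [integral_norm_sq_stdGaussian] using this
  have v2 : ∫ p : ℂ × ℂ, ‖p.2‖ ^ 2 ∂(stdGaussian.prod stdGaussian) = 1 := by
    have := integral_fun_snd (μ := stdGaussian) (ν := stdGaussian) (fun z : ℂ => ‖z‖ ^ 2)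
    simpa [integral_norm_sq_stdGaussian] using this
  rw [integral_add i12 i4, integral_add i1 i2, integral_const_mul, integral_const_mul, v1, v2, v3]
  ring

lemma mmseFun_stdGaussian (s : ℝ) : mmseFun stdGaussian s = (1 + s ^ 2)⁻¹ := by
  have ha : 0 < 1 + s ^ 2 := by positivity
  have h1 : ∀ y : ℂ, ‖inputMoment stdGaussian s y‖ ^ 2 / outputDensity stdGaussian s y =
      (s / (1 + s ^ 2)) ^ 2 * (outputDensity stdGaussian s y • ‖y‖ ^ 2) := by
    intro y
    have hp := outputDensity_pos (ν := stdGaussian) (g := (s : ℂ)) y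
    rw [inputMoment_stdGaussian, norm_smul, mul_pow, Real.norm_eq_abs, sq_abs, smul_eq_mul]
    field_simp
  rw [mmseFun, integral_norm_sq_stdGaussian]
  simp_rw [h1]
  rw [integral_const_mul, ← integral_comp_snd_jointLaw (f := fun y : ℂ => ‖y‖ ^ 2) (by fun_prop),
    jointLaw_eq_map, integral_map (by fun_prop) (by fun_prop),
    (integral_norm_add_sq_stdGaussian s).2]
  field_simp
  ring

lemma log_outputDensity_stdGaussian (s : ℝ) (y : ℂ) :
    Real.log (outputDensity stdGaussian s y) =
      s ^ 2 / (1 + s ^ 2) * ‖y‖ ^ 2 - Real.log (1 + s ^ 2) := by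
  have ha : 0 < 1 + s ^ 2 := by positivity
  rw [outputDensity_stdGaussian, Real.log_mul (by positivity) (Real.exp_ne_zero _), Real.log_exp,
    Real.log_inv]
  ring

lemma infoFun_stdGaussian (s : ℝ) : infoFun stdGaussian s = Real.log (1 + s ^ 2) := by
  have ha : 0 < 1 + s ^ 2 := by positivity
  obtain ⟨h1, h2⟩ := integral_norm_add_sq_stdGaussian s
  rw [infoFun, integral_norm_sq_stdGaussian]
  simp_rw [log_outputDensity_stdGaussian]
  rw [integral_sub (h1.const_mul _) (integrable_const _), integral_const_mul, h2, integral_const,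
    probReal_univ, Complex.norm_real, Real.norm_eq_abs, sq_abs, smul_eq_mul]
  field_simp
  ring

lemma isRegularInput_stdGaussian : IsRegularInput stdGaussian where
  memLp := by
    rw [memLp_two_iff_integrable_sq_norm (by fun_prop)]
    exact integrable_norm_pow_stdGaussian 2
  contDiffOn := by
    simp_rw [mmseFun_stdGaussian]
    have h : ContDiffOn ℝ (⊤ : ℕ∞) (fun t : ℝ => (1 + t)⁻¹) (Set.Ici 0) :=
      (contDiffOn_const.add contDiffOn_id).inv fun t ht => by
        have : (0 : ℝ) ≤ t := ht
        simp only [id]; positivity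
    exact h.congr fun t ht => by rw [Real.sq_sqrt ht]
  integrable_log s := by
    simp_rw [log_outputDensity_stdGaussian]
    exact ((integral_norm_add_sq_stdGaussian s).1.const_mul _).sub (integrable_const _)
  hasDerivWithinAt t ht := by
    simp_rw [infoFun_stdGaussian, mmseFun_stdGaussian]
    have h1 : HasDerivAt (fun t : ℝ => Real.log (1 + t)) (1 / (1 + t)) t :=
      ((hasDerivAt_id t).const_add 1).log (by positivity)
    rw [Real.sq_sqrt ht, ← one_div]
    exact h1.hasDerivWithinAt.congr (fun u hu => by rw [Real.sq_sqrt hu]) (by rw [Real.sq_sqrt ht])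

/-! ### All admissible inputs are regular -/

lemma isRegularInput_of_isInputLaw {ν : Measure ℂ} [IsProbabilityMeasure ν] (h : IsInputLaw ν) :
    IsRegularInput ν := by
  have hsq : ∀ c : ℝ, MeasurableSet (Set.Icc (-c) c ×ℂ Set.Icc (-c) c) := fun c =>
    (measurableSet_Icc.preimage Complex.measurable_re).inter
      (measurableSet_Icc.preimage Complex.measurable_im)
  rcases h with ⟨S, hS⟩ | rfl | rfl | rfl | rfl
  · refine isRegularInput_of_bounded (M := ∑ z ∈ S, ‖z‖) ?_
    filter_upwards [hS] with z hz
    exact Finset.single_le_sum (f := fun z : ℂ => ‖z‖) (fun z _ => norm_nonneg z) hz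
  · refine isRegularInput_of_bounded (M := 1) ?_
    rw [pskLaw, ae_map_iff (by fun_prop) (measurableSet_le (by fun_prop) (by fun_prop))]
    exact ae_of_all _ fun θ => (Complex.norm_exp_ofReal_mul_I θ).le
  · refine isRegularInput_of_bounded (M := √3) ?_
    rw [pamLaw, ae_map_iff (by fun_prop) (measurableSet_le (by fun_prop) (by fun_prop))]
    filter_upwards [ae_cond_mem measurableSet_Icc] with t ht
    rw [Complex.norm_real]
    exact abs_le.mpr ht
  · refine isRegularInput_of_bounded (M := √(3 / 2) + √(3 / 2)) ?_
    filter_upwards [ae_cond_mem (hsq (√(3 / 2)))] with z hz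
    exact (Complex.norm_le_abs_re_add_abs_im z).trans
      (add_le_add (abs_le.mpr hz.1) (abs_le.mpr hz.2))
  · exact isRegularInput_stdGaussian

/-! ### Asymptotic expansions -/

/-- Taylor's formula at the left end point with a remainder estimate on the whole half-line. -/
lemma exists_taylor_bound_Ici {m : ℝ → ℝ} (hm : ContDiffOn ℝ (⊤ : ℕ∞) m (Set.Ici 0)) {B : ℝ}
    (hB : ∀ t, 0 ≤ t → |m t| ≤ B) (k : ℕ) :
    ∃ C : ℝ, 0 ≤ C ∧ ∀ t, 0 ≤ t →
      |m t - ∑ j ∈ Finset.range (k + 1),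
        iteratedDerivWithin j m (Set.Ici 0) 0 / j.factorial * t ^ j| ≤ C * t ^ (k + 1) := by
  set a : ℕ → ℝ := fun j => iteratedDerivWithin j m (Set.Ici 0) 0 / j.factorial with ha
  have hm1 : ContDiffOn ℝ (k + 1) m (Set.Icc 0 1) :=
    (hm.mono Set.Icc_subset_Ici_self).of_le (by exact_mod_cast le_top)
  obtain ⟨C, hC⟩ := exists_taylor_mean_remainder_bound zero_le_one hm1
  have hT : ∀ t, taylorWithinEval m k (Set.Icc 0 1) 0 t = ∑ j ∈ Finset.range (k + 1), a j * t ^ j := by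
    intro t
    rw [taylor_within_apply]
    refine Finset.sum_congr rfl fun j _ => ?_
    -- Iterated one-sided derivatives at `0` depend only on the germ of the set there.
    have : Set.Icc (0 : ℝ) 1 =ᶠ[𝓝 0] Set.Ici 0 := by
      filter_upwards [Iio_mem_nhds (zero_lt_one (α := ℝ))] with t ht
      exact propext ⟨fun h => h.1, fun h => ⟨h, le_of_lt ht⟩⟩
    rw [iteratedDerivWithin, iteratedFDerivWithin_congr_set this, ← iteratedDerivWithin, ha,
      sub_zero, smul_eq_mul]
    ring
  have hB0 : 0 ≤ B := (abs_nonneg _).trans (hB 0 le_rfl)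
  have hS0 : 0 ≤ ∑ j ∈ Finset.range (k + 1), |a j| := Finset.sum_nonneg fun j _ => abs_nonneg _
  -- `|C|` is the Taylor constant on `[0, 1]`. For `t ≥ 1` the function and the polynomial are
  -- bounded separately, every power `t^j` with `j ≤ k` being at most `t^(k+1)`.
  refine ⟨|C| + (B + ∑ j ∈ Finset.range (k + 1), |a j|), by positivity, fun t ht => ?_⟩
  have htk : 0 ≤ t ^ (k + 1) := by positivity
  rcases le_total t 1 with h1 | h1
  · have h2 := hC t ⟨ht, h1⟩
    rw [hT, sub_zero, Real.norm_eq_abs] at h2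
    nlinarith [le_abs_self C]
  · have h3 : |∑ j ∈ Finset.range (k + 1), a j * t ^ j| ≤
        (∑ j ∈ Finset.range (k + 1), |a j|) * t ^ (k + 1) := by
      rw [Finset.sum_mul]
      refine (Finset.abs_sum_le_sum_abs _ _).trans (Finset.sum_le_sum fun j hj => ?_)
      rw [abs_mul, abs_pow, abs_of_nonneg ht]
      exact mul_le_mul_of_nonneg_left (pow_le_pow_right₀ h1 (Finset.mem_range.mp hj).le)
        (abs_nonneg _)
    have h4 : B ≤ B * t ^ (k + 1) := le_mul_of_one_le_right hB0 (one_le_pow₀ h1)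
    have h5 := abs_sub (m t) (∑ j ∈ Finset.range (k + 1), a j * t ^ j)
    nlinarith [hB t ht, mul_nonneg (abs_nonneg C) htk]

/-- Termwise integration of a Taylor expansion. -/
lemma abs_sub_sum_le_of_hasDerivWithinAt {m J : ℝ → ℝ} {a : ℕ → ℝ} {C : ℝ} {k : ℕ} (hC : 0 ≤ C)
    (hJ : ∀ t, 0 ≤ t → HasDerivWithinAt J (m t) (Set.Ici 0) t) (hJ0 : J 0 = 0)
    (hm : ∀ t, 0 ≤ t → |m t - ∑ j ∈ Finset.range k, a j * t ^ j| ≤ C * t ^ k) {t : ℝ}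
    (ht : 0 ≤ t) :
    |J t - ∑ j ∈ Finset.range k, a j / (j + 1) * t ^ (j + 1)| ≤ C * t ^ (k + 1) := by
  have hd : ∀ u ∈ Set.Icc 0 t, HasDerivWithinAt
      (fun u => J u - ∑ j ∈ Finset.range k, a j / (j + 1) * u ^ (j + 1))
      (m u - ∑ j ∈ Finset.range k, a j * u ^ j) (Set.Icc 0 t) u := by
    intro u hu
    refine ((hJ u hu.1).mono Set.Icc_subset_Ici_self).sub (HasDerivWithinAt.fun_sum fun j _ => ?_)
    have h1 := ((hasDerivAt_id u).pow (j + 1)).const_mul (a j / (j + 1))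
    have h2 : (j : ℝ) + 1 ≠ 0 := by positivity
    refine (HasDerivAt.hasDerivWithinAt ?_)
    convert! h1 using 1
    simp
    field_simp
  have hb : ∀ u ∈ Set.Ico 0 t, ‖m u - ∑ j ∈ Finset.range k, a j * u ^ j‖ ≤ C * t ^ k := by
    intro u hu
    refine (hm u hu.1).trans (mul_le_mul_of_nonneg_left ?_ hC)
    exact pow_le_pow_left₀ hu.1 hu.2.le k
  have := norm_image_sub_le_of_norm_deriv_le_segment' hd hb t ⟨ht, le_rfl⟩
  simpa [hJ0, pow_succ, mul_assoc] using this

/-- Averaging an expansion over a random scale all of whose moments are finite. -/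
lemma abs_integral_sub_sum_le {Ω : Type*} [MeasurableSpace Ω] {P : Measure Ω} {q Φ : Ω → ℝ}
    {b : ℕ → ℝ} {s C : ℝ} {N e : ℕ} (hq : ∀ k : ℕ, Integrable (fun ω => q ω ^ k) P)
    (hΦ : Integrable Φ P)
    (h : ∀ ω, |Φ ω - ∑ j ∈ Finset.range N, b j * q ω ^ (j + 1) * s ^ (j + e)| ≤
      C * q ω ^ (N + 1) * s ^ (N + e)) :
    |∫ ω, Φ ω ∂P - ∑ j ∈ Finset.range N, b j * (∫ ω, q ω ^ (j + 1) ∂P) * s ^ (j + e)| ≤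
      C * (∫ ω, q ω ^ (N + 1) ∂P) * s ^ (N + e) := by
  have hj : ∀ j ∈ Finset.range N, Integrable (fun ω => b j * q ω ^ (j + 1) * s ^ (j + e)) P :=
    fun j _ => ((hq (j + 1)).const_mul (b j)).mul_const _
  have h1 : ∑ j ∈ Finset.range N, b j * (∫ ω, q ω ^ (j + 1) ∂P) * s ^ (j + e) =
      ∫ ω, ∑ j ∈ Finset.range N, b j * q ω ^ (j + 1) * s ^ (j + e) ∂P := by
    rw [integral_finsetSum _ hj]
    refine Finset.sum_congr rfl fun j _ => ?_
    rw [integral_mul_const, integral_const_mul]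
  rw [h1, ← integral_sub hΦ (integrable_finsetSum _ hj), ← integral_const_mul, ← integral_mul_const]
  rw [← Real.norm_eq_abs]
  exact norm_integral_le_of_norm_le (((hq (N + 1)).const_mul C).mul_const (s ^ (N + e)))
    (ae_of_all _ h)

lemma hasAsymptoticExpansion_pow {f : ℝ → ℝ} {a : ℕ → ℝ} (e : ℕ)
    (h : ∀ N : ℕ, ∃ C : ℝ, ∀ s, 0 < s →
      |f s - ∑ j ∈ Finset.range (N + 1), a j * s ^ (j + e)| ≤ C * s ^ (N + 1 + e)) :
    HasAsymptoticExpansion f a (fun j s => s ^ (j + e)) (𝓝[>] 0) := by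
  refine ⟨fun j => continuous_pow _, fun j => ?_, fun N => ?_⟩
  · exact (isLittleO_pow_pow (by omega)).mono nhdsWithin_le_nhds
  · obtain ⟨C, hC⟩ := h N
    refine IsBigO.of_bound C ?_
    filter_upwards [self_mem_nhdsWithin] with s hs
    have hs' : 0 < s := hs
    rw [Real.norm_eq_abs, Real.norm_of_nonneg (by positivity)]
    exact hC s hs'

section Regular

variable {ν : Measure ℂ}

/-- The square root is `0` on the negative axis, so continuity on `[0, ∞)` extends to the line. This
provides measurability after composition with the random gain. -/
lemma IsRegularInput.continuous_mmse (h : IsRegularInput ν) :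
    Continuous (fun t : ℝ => mmseFun ν ((√t : ℝ) : ℂ)) := by
  have h1 : Continuous fun t : ℝ => mmseFun ν ((√(max t 0) : ℝ) : ℂ) :=
    h.contDiffOn.continuousOn.comp_continuous (continuous_id.max continuous_const)
      fun t => Set.mem_Ici.mpr (le_max_right _ _)
  refine h1.congr fun t => ?_
  rcases le_total t 0 with ht | ht
  · rw [max_eq_right ht, Real.sqrt_zero, Real.sqrt_eq_zero_of_nonpos ht]
  · rw [max_eq_left ht]

lemma IsRegularInput.continuous_info (h : IsRegularInput ν) :
    Continuous (fun t : ℝ => infoFun ν ((√t : ℝ) : ℂ)) := by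
  have hc : ContinuousOn (fun t : ℝ => infoFun ν ((√t : ℝ) : ℂ)) (Set.Ici 0) :=
    fun t ht => (h.hasDerivWithinAt t ht).continuousWithinAt
  have h1 : Continuous fun t : ℝ => infoFun ν ((√(max t 0) : ℝ) : ℂ) :=
    hc.comp_continuous (continuous_id.max continuous_const) fun t => Set.mem_Ici.mpr (le_max_right _ _)
  refine h1.congr fun t => ?_
  rcases le_total t 0 with ht | ht
  · rw [max_eq_right ht, Real.sqrt_zero, Real.sqrt_eq_zero_of_nonpos ht]
  · rw [max_eq_left ht]

variable [IsProbabilityMeasure ν]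

lemma infoFun_zero : infoFun ν ((√0 : ℝ) : ℂ) = 0 := by
  simp [infoFun, outputDensity, tilt]

lemma mmseFun_le (g : ℂ) : mmseFun ν g ≤ ∫ x, ‖x‖ ^ 2 ∂ν := by
  have : 0 ≤ ∫ y, ‖inputMoment ν g y‖ ^ 2 / outputDensity ν g y ∂stdGaussian :=
    integral_nonneg fun y => div_nonneg (sq_nonneg _) (outputDensity_pos y).le
  rw [mmseFun]
  linarith

/-- The derivative is the nonnegative MMSE and the value at `0` is zero. Positivity ensures that the
`ENNReal.ofReal` in `condMutualInfo_eq` truncates nothing. -/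
lemma IsRegularInput.infoFun_nonneg (h : IsRegularInput ν)
    (h0 : ∀ t : ℝ, 0 ≤ mmseFun ν ((√t : ℝ) : ℂ)) {t : ℝ} (ht : 0 ≤ t) :
    0 ≤ infoFun ν ((√t : ℝ) : ℂ) := by
  have hmono : MonotoneOn (fun t : ℝ => infoFun ν ((√t : ℝ) : ℂ)) (Set.Ici 0) := by
    refine monotoneOn_of_hasDerivWithinAt_nonneg (convex_Ici 0) h.continuous_info.continuousOn
      (fun t ht => ?_) (fun t _ => h0 t)
    have ht' : t ∈ Set.Ici (0 : ℝ) := interior_subset ht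
    exact (h.hasDerivWithinAt t ht').mono interior_subset
  exact infoFun_zero.symm.le.trans (hmono (Set.mem_Ici.mpr le_rfl) ht ht)

end Regular

end FadingChannel

/-! ### Averaging over the fading -/

open FadingChannel

theorem mainTheorem8 {Ω : Type*} [MeasurableSpace Ω] (P : Measure Ω) [IsProbabilityMeasure P]
    (x h n : Ω → ℂ) (hx : Measurable x) (hh : Measurable h) (hn : Measurable n)
    (hindep : iIndepFun ![x, h, n] P)
    (hxlaw : FadingChannel.IsInputLaw (P.map x))
    (μ : ℂ) (σ : ℝ) (hσ : 0 < σ)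
    (hhlaw : P.map h = FadingChannel.complexGaussian μ (2 * σ ^ 2))
    (hnlaw : P.map n = FadingChannel.complexGaussian 0 1) :
    -- all one-sided derivatives `mmse^{(m)}(0⁺)` of the canonical MMSE exist
    ContDiffWithinAt ℝ ((⊤ : ℕ∞) : WithTop ℕ∞) (FadingChannel.canonicalMmse P x n) (Set.Ici 0) 0 ∧
    -- the average MMSE is well defined and has the stated low-snr expansion
    (∀ snr : ℝ, 0 ≤ snr → Integrable (fun ω => FadingChannel.condMmse P x n (h ω) snr) P) ∧
    FadingChannel.HasAsymptoticExpansion (FadingChannel.avgMmse P x h n)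
      (fun m => Real.exp (-(‖μ‖ ^ 2 / (2 * σ ^ 2))) *
        ((m + 1) * (2 * σ ^ 2) ^ (m + 1) *
          FadingChannel.confluentHypergeometric (2 + m) 1 (‖μ‖ ^ 2 / (2 * σ ^ 2)) *
          iteratedDerivWithin m (FadingChannel.canonicalMmse P x n) (Set.Ici 0) 0))
      (fun m snr => snr ^ m) (𝓝[>] 0) ∧
    -- the average mutual information is finite and has the stated low-snr expansion
    (∀ snr : ℝ, 0 ≤ snr → FadingChannel.avgMutualInfo P x h n snr ≠ ⊤) ∧
    FadingChannel.HasAsymptoticExpansion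
      (fun snr => (FadingChannel.avgMutualInfo P x h n snr).toReal)
      (fun m => Real.exp (-(‖μ‖ ^ 2 / (2 * σ ^ 2))) *
        ((2 * σ ^ 2) ^ (m + 1) *
          FadingChannel.confluentHypergeometric (2 + m) 1 (‖μ‖ ^ 2 / (2 * σ ^ 2)) *
          iteratedDerivWithin m (FadingChannel.canonicalMmse P x n) (Set.Ici 0) 0))
      (fun m snr => snr ^ (m + 1)) (𝓝[>] 0) := by
  set ν := P.map x with hν
  have : IsProbabilityMeasure ν := Measure.isProbabilityMeasure_map hx.aemeasurable
  have hreg := isRegularInput_of_isInputLaw hxlaw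
  have hind : IndepFun x n P := hindep.indepFun (i := 0) (j := 2) (by decide)
  set m : ℝ → ℝ := fun t => mmseFun ν ((√t : ℝ) : ℂ) with hm
  set J : ℝ → ℝ := fun t => infoFun ν ((√t : ℝ) : ℂ) with hJ
  have hmm : ∀ h₀ s, condMmse P x n h₀ s = ‖h₀‖ ^ 2 * m (‖h₀‖ ^ 2 * s) :=
    condMmse_eq hx hn hind hν.symm hnlaw hreg.memLp
  have hII : ∀ h₀ s, condMutualInfo P x n h₀ s = ENNReal.ofReal (J (‖h₀‖ ^ 2 * s)) :=
    condMutualInfo_eq hx hn hind hν.symm hnlaw hreg.memLp hreg.integrable_log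
  have hcan : canonicalMmse P x n = m := by
    ext t
    simp [canonicalMmse, hmm]
  have hm0 : ∀ t, 0 ≤ m t := by
    intro t
    rw [← hcan]
    exact integral_nonneg fun ω => sq_nonneg _
  set B := ∫ x, ‖x‖ ^ 2 ∂ν with hBdef
  have hmB : ∀ t, 0 ≤ t → |m t| ≤ B := fun t _ => by
    rw [abs_of_nonneg (hm0 t)]
    exact mmseFun_le _
  have hJd : ∀ t, 0 ≤ t → HasDerivWithinAt J (m t) (Set.Ici 0) t := hreg.hasDerivWithinAt
  have hJ0 : J 0 = 0 := infoFun_zero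
  have hJnn : ∀ t, 0 ≤ t → 0 ≤ J t := fun t ht => hreg.infoFun_nonneg hm0 ht
  have hmc : Continuous m := hreg.continuous_mmse
  have hJc : Continuous J := hreg.continuous_info
  -- the moments of the channel power
  set q : Ω → ℝ := fun ω => ‖h ω‖ ^ 2 with hq
  have hq0 : ∀ ω, 0 ≤ q ω := fun ω => sq_nonneg _
  have hqm : Measurable q := by rw [hq]; fun_prop
  have hqi : ∀ k : ℕ, Integrable (fun ω => q ω ^ k) P := by
    intro k
    have h1 := (integral_norm_pow_complexGaussian μ hσ k).1
    rw [← hhlaw, integrable_map_measure (by fun_prop) hh.aemeasurable] at h1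
    exact h1.congr (ae_of_all _ fun ω => by simp [hq, pow_mul])
  have hqM : ∀ k : ℕ, ∫ ω, q ω ^ (k + 1) ∂P = (k + 1).factorial * (2 * σ ^ 2) ^ (k + 1) *
      (Real.exp (-(‖μ‖ ^ 2 / (2 * σ ^ 2))) *
        confluentHypergeometric (2 + k) 1 (‖μ‖ ^ 2 / (2 * σ ^ 2))) := by
    intro k
    have h1 := (integral_norm_pow_complexGaussian μ hσ (k + 1)).2
    rw [← hhlaw, integral_map hh.aemeasurable (by fun_prop)] at h1
    rw [show (2 : ℝ) + k = 1 + ((k + 1 : ℕ) : ℝ) by push_cast; ring, ← h1]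
    simp [hq, pow_mul]
  -- integrability of the conditional quantities
  have hmi : ∀ s : ℝ, 0 ≤ s → Integrable (fun ω => q ω * m (q ω * s)) P := by
    intro s hs
    refine ((hqi 1).mul_const B).mono' (by fun_prop) (ae_of_all _ fun ω => ?_)
    rw [norm_mul, Real.norm_of_nonneg (hq0 ω), pow_one]
    exact mul_le_mul_of_nonneg_left (hmB _ (mul_nonneg (hq0 ω) hs)) (hq0 ω)
  have hJi : ∀ s : ℝ, 0 ≤ s → Integrable (fun ω => J (q ω * s)) P := by
    intro s hs
    refine (((hqi 1).const_mul B).mul_const s).mono' (by fun_prop) (ae_of_all _ fun ω => ?_)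
    -- With an empty sum, termwise integration is the linear bound `|J t| ≤ B t`, which makes `J(q
    -- s)` integrable.
    have h1 := abs_sub_sum_le_of_hasDerivWithinAt (k := 0) (a := fun _ => 0)
      ((abs_nonneg _).trans (hmB 0 le_rfl)) hJd hJ0 (by simpa using hmB) (mul_nonneg (hq0 ω) hs)
    simpa [mul_assoc] using h1
  have hJavg : ∀ s : ℝ, 0 ≤ s →
      avgMutualInfo P x h n s = ENNReal.ofReal (∫ ω, J (q ω * s) ∂P) := by
    intro s hs
    rw [ofReal_integral_eq_lintegral_ofReal (hJi s hs)
      (ae_of_all _ fun ω => hJnn _ (mul_nonneg (hq0 ω) hs))]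
    exact lintegral_congr fun ω => hII _ _
  rw [hcan]
  refine ⟨hreg.contDiffOn 0 (Set.mem_Ici.mpr le_rfl), fun s hs => ?_, ?_, fun s hs => ?_, ?_⟩
  · simpa only [hmm] using hmi s hs
  · refine hasAsymptoticExpansion_pow 0 fun N => ?_
    obtain ⟨C, hC, hT⟩ := exists_taylor_bound_Ici hreg.contDiffOn hmB N
    refine ⟨C * ∫ ω, q ω ^ (N + 1 + 1) ∂P, fun s hs => ?_⟩
    have h1 := abs_integral_sub_sum_le (Φ := fun ω => q ω * m (q ω * s)) (N := N + 1) (e := 0)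
      (b := fun j => iteratedDerivWithin j m (Set.Ici 0) 0 / j.factorial) (s := s) (C := C) hqi
      (hmi s hs.le) fun ω => by
        have h2 := mul_le_mul_of_nonneg_left (hT (q ω * s) (mul_nonneg (hq0 ω) hs.le)) (hq0 ω)
        rw [← abs_of_nonneg (hq0 ω), ← abs_mul, abs_of_nonneg (hq0 ω), mul_sub, Finset.mul_sum] at h2
        convert! h2 using 1
        · congr 2
          refine Finset.sum_congr rfl fun j _ => ?_
          rw [mul_pow]; ring
        · rw [mul_pow]; ring
    convert! h1 using 1
    congr 2
    · simp only [avgMmse, hmm]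
      rfl
    · refine Finset.sum_congr rfl fun j _ => ?_
      -- The Taylor coefficient carries `1/j!` and the moment of order `j + 1` carries `(j+1)!`; the
      -- quotient is the factor `j + 1`.
      rw [hqM, Nat.factorial_succ]
      push_cast
      field_simp
  · rw [hJavg s hs]
    exact ENNReal.ofReal_ne_top
  · refine hasAsymptoticExpansion_pow 1 fun N => ?_
    obtain ⟨C, hC, hT⟩ := exists_taylor_bound_Ici hreg.contDiffOn hmB N
    refine ⟨C * ∫ ω, q ω ^ (N + 1 + 1) ∂P, fun s hs => ?_⟩
    have h1 := abs_integral_sub_sum_le (Φ := fun ω => J (q ω * s)) (N := N + 1) (e := 1)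
      (b := fun j => iteratedDerivWithin j m (Set.Ici 0) 0 / j.factorial / (j + 1)) (s := s) (C := C)
      hqi (hJi s hs.le) fun ω => by
        have h2 := abs_sub_sum_le_of_hasDerivWithinAt hC hJd hJ0 hT (mul_nonneg (hq0 ω) hs.le)
        convert! h2 using 1
        · congr 2
          refine Finset.sum_congr rfl fun j _ => ?_
          rw [mul_pow]; ring
        · rw [mul_pow]; ring
    rw [hJavg s hs.le, ENNReal.toReal_ofReal
      (integral_nonneg fun ω => hJnn _ (mul_nonneg (hq0 ω) hs.le))]
    convert! h1 using 1
    congr 2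
    refine Finset.sum_congr rfl fun j _ => ?_
    -- The extra `1/(j+1)` from integrating the Taylor expansion cancels the factor left by the
    -- factorials.
    rw [hqM, Nat.factorial_succ]
    push_cast
    field_simp
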